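/- All graphs $G=(V,E)$ are finite, simple and undirected, with $V=\{0,\dots,n-1\}$ and nonnegative real edge weights $w$ (the graph need not be connected); $d_G(u,v)\in[0,\infty]$ is the shortest-path distance. For $H\subseteq\binom V2$, the graph $G\cup H$ is $G$ with the additional edges $H$, where every $\{x,y\}\in H$ has weight $d_G(x,y)$ and the other edges keep their weights; $d^{(\beta)}_{G\cup H}(u,v)$ is the least weight of a $u$–$v$ path in $G\cup H$ with at most $\beta$ edges. $H$ is a *hopset with stretch $\alpha$ and hopbound $\beta$* if $d^{(\beta)}_{G\cup H}(u,v)\le\alpha\, d_G(u,v)$ for all $u,v\in V$. A *path-reporting preserver* for a set $H\subseteq\binom V2$ is a pair $(S,D)$, where $S$ is a subgraph of $G$ and $D$ is a stored data structure (a list of words of $O(\log n)$ bits), such that for all $u,v$ with $\{u,v\}\in H$ a query algorithm with access to $D$ returns, on input $(u,v)$, the successive vertices of a $u$–$v$ path $P$ in $S$ with $w(P)\le d_G(u,v)$, within time $O(1+|P|)$ on a word RAM with words of $O(\log n)$ bits, where $|P|$ is the number of edges of $P$. The query algorithm is one fixed program, independent of the graph and of all parameters. The *size* of $(S,D)$ is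 $\max\{|E_S|,|D|\}$, where $|D|$ is the number of words of $D$. **Theorem.** There are a query program and absolute constants (behind all $O(\cdot)$ here, including those in the definition of a preserver) such that the following holds. Let $G=(V,E)$ be an undirected weighted graph on $n$ vertices, and let $1<c\le k$ be integers. There is a hopset $H$ for $G$ with stretch $8c+3$, hopbound $O\left(\frac1c\cdot k^{1+\frac{2}{\ln c}}\right)$ and size $|H|=O\left(cn\log_c k+ck^{\frac{9}{c-1}}n^{1+\frac1k}\right)$. Moreover, $H$ can be divided into three pairwise disjoint subsets $H=H_1\cup H_2\cup H_3$ such that $H_1$ has a path-reporting preserver of size $O(cn\log_c k)$, $H_2$ has a path-reporting preserver of size $O\left(ck^{\frac{9}{c-1}}n^{1+\frac1k}\right)$, and $$|H_3|=O\left(ck^{-9}n^{1+\frac1k}\right).$$ -/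

import Mathlib

open scoped NNReal ENNReal

/-! ## Weighted graphs, distances and hopsets

A weighted undirected graph is a simple graph `G` together with a weight function
`w : Sym2 V → ℝ≥0`; only the values of `w` at the edges of `G` matter. -/

section Distances

variable {V : Type*}

/-- The total weight of the edges of a walk. -/
noncomputable def walkWeight {G : SimpleGraph V} (w : Sym2 V → ℝ≥0∞) {u v : V}
    (p : G.Walk u v) : ℝ≥0∞ :=
  (p.edges.map w).sum

/-- The shortest-path distance `d_G(u, v)`; it is `∞` if no path joins `u` and `v`. -/
noncomputable def graphDist (G : SimpleGraph V) (w : Sym2 V → ℝ≥0) (u v : V) : ℝ≥0∞ :=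
  ⨅ p : G.Walk u v, walkWeight (fun e => (w e : ℝ≥0∞)) p

theorem graphDist_comm (G : SimpleGraph V) (w : Sym2 V → ℝ≥0) (u v : V) :
    graphDist G w u v = graphDist G w v u := by
  have key : ∀ x y : V, graphDist G w x y ≤ graphDist G w y x := by
    intro x y
    refine le_iInf fun p => (iInf_le _ p.reverse).trans (le_of_eq ?_)
    simp [walkWeight, SimpleGraph.Walk.edges_reverse, List.map_reverse, List.sum_reverse]
  exact le_antisymm (key u v) (key v u)

/-- The distance `d_G(x, y)` as a function of the unordered pair `{x, y}`. -/
noncomputable def pairDist (G : SimpleGraph V) (w : Sym2 V → ℝ≥0) : Sym2 V → ℝ≥0∞ :=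
  Sym2.lift ⟨graphDist G w, graphDist_comm G w⟩

variable [DecidableEq V]

/-- The graph `G ∪ H`. -/
def addPairs (G : SimpleGraph V) (H : Finset (Sym2 V)) : SimpleGraph V :=
  G ⊔ SimpleGraph.fromEdgeSet (H : Set (Sym2 V))

/-- The edge weights of `G ∪ H`: a pair of `H` weighs the distance in `G` of its endpoints, and
every other edge keeps its weight. -/
noncomputable def addPairsWeight (G : SimpleGraph V) (w : Sym2 V → ℝ≥0) (H : Finset (Sym2 V))
    (e : Sym2 V) : ℝ≥0∞ :=
  if e ∈ H then pairDist G w e else (w e : ℝ≥0∞)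

/-- `d^{(β)}_{G ∪ H}(u, v)`: the least weight of a `u`-`v` walk in `G ∪ H` with at most `β`
edges. -/
noncomputable def hopDist (G : SimpleGraph V) (w : Sym2 V → ℝ≥0) (H : Finset (Sym2 V)) (β : ℕ)
    (u v : V) : ℝ≥0∞ :=
  ⨅ (p : (addPairs G H).Walk u v) (_ : p.length ≤ β), walkWeight (addPairsWeight G w H) p

/-- `H ⊆ (V choose 2)` is a hopset for `(G, w)` with stretch `α` and hopbound `β`. -/
def IsHopset (G : SimpleGraph V) (w : Sym2 V → ℝ≥0) (H : Finset (Sym2 V)) (α : ℝ≥0∞) (β : ℕ) :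
    Prop :=
  (∀ e ∈ H, ¬ e.IsDiag) ∧ ∀ u v : V, hopDist G w H β u v ≤ α * graphDist G w u v

end Distances

/-! ## A word RAM

Query algorithms are programs for a random access machine whose registers and memory cells hold
natural numbers below a bound `B` (a word of `b` bits for `B = 2 ^ b`); all results are reduced
modulo `B`. A program has random access to a read-only list `D` of words (the stored data
structure) and to a working memory which is initially zero, and it can emit words as output. -/

/-- The arithmetic operations of the machine. -/
inductive WordOp
  | add
  | sub
  | mul
  | div
  | mod

/-- The value of an operation (subtraction is truncated, `x / 0 = 0`, `x % 0 = x`). -/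
def WordOp.eval : WordOp → ℕ → ℕ → ℕ
  | .add, x, y => x + y
  | .sub, x, y => x - y
  | .mul, x, y => x * y
  | .div, x, y => x / y
  | .mod, x, y => x % y

/-- Programs; the registers are numbered by natural numbers. -/
inductive RamProgram
  /-- `reg r := a` -/
  | const (r a : ℕ)
  /-- `reg r := reg s (o) reg t` -/
  | arith (o : WordOp) (r s t : ℕ)
  /-- `reg r := D[reg s]`, which is `0` beyond the end of `D` -/
  | fetch (r s : ℕ)
  /-- `reg r := work[reg s]` -/
  | load (r s : ℕ)
  /-- `work[reg s] := reg r` -/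
  | store (r s : ℕ)
  /-- append `reg r` to the output -/
  | emit (r : ℕ)
  /-- do nothing -/
  | skip
  /-- first `P`, then `Q` -/
  | seq (P Q : RamProgram)
  /-- `P` if `reg r ≠ 0`, and `Q` otherwise -/
  | cond (r : ℕ) (P Q : RamProgram)
  /-- repeat `P` as long as `reg r ≠ 0` -/
  | loop (r : ℕ) (P : RamProgram)

/-- The state of the machine: registers, working memory, output so far. -/
structure RamState where
  reg : ℕ → ℕ
  work : ℕ → ℕ
  output : List ℕ

/-- `RamExec B D P σ t τ`: with words below `B` and read-only data `D`, the program `P`, started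
in the state `σ`, halts after `t` steps in the state `τ`. Every elementary instruction and every
test takes one step. -/
inductive RamExec (B : ℕ) (D : List ℕ) : RamProgram → RamState → ℕ → RamState → Prop
  | const (r a : ℕ) (σ : RamState) :
      RamExec B D (.const r a) σ 1 { σ with reg := Function.update σ.reg r (a % B) }
  | arith (o : WordOp) (r s t : ℕ) (σ : RamState) :
      RamExec B D (.arith o r s t) σ 1
        { σ with reg := Function.update σ.reg r (o.eval (σ.reg s) (σ.reg t) % B) }
  | fetch (r s : ℕ) (σ : RamState) :
      RamExec B D (.fetch r s) σ 1
        { σ with reg := Function.update σ.reg r (D.getD (σ.reg s) 0) }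
  | load (r s : ℕ) (σ : RamState) :
      RamExec B D (.load r s) σ 1
        { σ with reg := Function.update σ.reg r (σ.work (σ.reg s)) }
  | store (r s : ℕ) (σ : RamState) :
      RamExec B D (.store r s) σ 1
        { σ with work := Function.update σ.work (σ.reg s) (σ.reg r) }
  | emit (r : ℕ) (σ : RamState) :
      RamExec B D (.emit r) σ 1 { σ with output := σ.output ++ [σ.reg r] }
  | skip (σ : RamState) : RamExec B D .skip σ 1 σ
  | seq {P Q : RamProgram} {σ τ υ : RamState} {t s : ℕ} :
      RamExec B D P σ t τ → RamExec B D Q τ s υ → RamExec B D (.seq P Q) σ (t + s) υ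
  | cond_true {r : ℕ} {P Q : RamProgram} {σ τ : RamState} {t : ℕ} :
      σ.reg r ≠ 0 → RamExec B D P σ t τ → RamExec B D (.cond r P Q) σ (1 + t) τ
  | cond_false {r : ℕ} {P Q : RamProgram} {σ τ : RamState} {t : ℕ} :
      σ.reg r = 0 → RamExec B D Q σ t τ → RamExec B D (.cond r P Q) σ (1 + t) τ
  | loop_done {r : ℕ} {P : RamProgram} {σ : RamState} :
      σ.reg r = 0 → RamExec B D (.loop r P) σ 1 σ
  | loop_step {r : ℕ} {P : RamProgram} {σ τ υ : RamState} {t s : ℕ} :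
      σ.reg r ≠ 0 → RamExec B D P σ t τ → RamExec B D (.loop r P) τ s υ →
        RamExec B D (.loop r P) σ (1 + t + s) υ

/-- The initial state on the query `(x, y)`: `x` and `y` are in the registers `0` and `1`,
everything else is zero, and nothing has been output. -/
def queryState (x y : ℕ) : RamState where
  reg := fun r => if r = 0 then x else if r = 1 then y else 0
  work := fun _ => 0
  output := []

/-- On the query `(x, y)` the program `Q` with stored data `D` outputs the list `l` and halts
within `t` steps. -/
def Answers (B : ℕ) (Q : RamProgram) (D : List ℕ) (x y : ℕ) (l : List ℕ) (t : ℕ) : Prop :=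
  ∃ (s : ℕ) (τ : RamState), RamExec B D Q (queryState x y) s τ ∧ s ≤ t ∧ τ.output = l

/-! ## Path-reporting pairwise spanners -/

/-- The bound on the words for graphs with `n` vertices: words of `a * (⌊log₂ n⌋ + 1)` bits. -/
def wordBound (a n : ℕ) : ℕ := 2 ^ (a * (Nat.log 2 n + 1))

/-- `(S, D)` is a path-reporting `P`-pairwise `α`-spanner for `(G, w)`, when `D` is queried with
the program `Q` on a machine with words of `a * (⌊log₂ n⌋ + 1)` bits: `S` is a subgraph of `G`,
and for every `(u, v) ∈ P` the oracle reports the successive vertices of a `u`-`v` path `p` in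
`S` of weight at most `α * d_G(u, v)`, within `T * (q + |p|)` steps. -/
def IsPathReportingSpanner {n : ℕ} (Q : RamProgram) (a T q : ℕ) (G : SimpleGraph (Fin n))
    (w : Sym2 (Fin n) → ℝ≥0) (P : Set (Fin n × Fin n)) (α : ℝ≥0∞)
    (S : SimpleGraph (Fin n)) (D : List ℕ) : Prop :=
  S ≤ G ∧ (∀ x ∈ D, x < wordBound a n) ∧
    ∀ u v : Fin n, (u, v) ∈ P → ∃ p : S.Walk u v, p.IsPath ∧
      walkWeight (fun e => (w e : ℝ≥0∞)) p ≤ α * graphDist G w u v ∧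
      Answers (wordBound a n) Q D u.val v.val (p.support.map Fin.val) (T * (q + p.length))

/-- The size `max {|E_S|, |D|}` of a path-reporting spanner, `|D|` being measured in words. -/
noncomputable def spannerSize {n : ℕ} (S : SimpleGraph (Fin n)) (D : List ℕ) : ℕ :=
  max S.edgeSet.ncard D.length

/-- The set `H` of unordered pairs has a path-reporting preserver (a path-reporting pairwise
`1`-spanner) of size at most `m`, with reporting time `T * (1 + |p|)`, that is, with query time
`O(1)`. The pairs may be queried in either order. -/
def HasPathReportingPreserver {n : ℕ} (Q : RamProgram) (a T : ℕ) (G : SimpleGraph (Fin n))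
    (w : Sym2 (Fin n) → ℝ≥0) (H : Finset (Sym2 (Fin n))) (m : ℝ) : Prop :=
  ∃ (S : SimpleGraph (Fin n)) (D : List ℕ),
    IsPathReportingSpanner Q a T 1 G w {x | s(x.1, x.2) ∈ H} 1 S D ∧ (spannerSize S D : ℝ) ≤ m

/-! The construction is a sampled hierarchy `A 0 = V ⊇ A 1 ⊇ ... ⊇ A F = ∅` whose levels are cut
into groups of `c`. The hopset joins every vertex to its pivot (nearest vertex) in each level, and
every vertex of the base `A (i / c * c)` of a group to its bunch in level `i`, the vertices of `A i`
nearer than all of `A (i + 1)`. Here `H₁` collects the pivots, `H₂` the bunches of the first group,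
and `H₃` the bunches of the later groups.

Sizes. With `η = n ^ (1/k)`, level `i` of group `j` is sampled at rate about `η ^ (-(c+1)^j)`, so
the base of group `j` has shrunk by just enough to pay for its bunches, and after about `c log_c k`
levels nothing is left. In the first group the rate carries an extra `κ⁻¹`, `κ = k ^ (9/(c-1))`: its
bunches grow by `κ`, while all later bases shrink by `κ ^ c`, which gives the `k ^ (-9)` for `H₃`.
Suitable samples exist by averaging (`exists_sample`, `exists_hierarchy`).

Stretch. Within a group, two base vertices at distance at most `D` are joined by two hops of weight
`O(c D)`, or else both are close to the next base (`two_hops_or_near`). Radii growing by the factor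
`6c+1` per group therefore single out, for each `u`, a group at which `u` is near the base but far
from the next one; there four hops and a crossing edge advance along the shortest path with stretch
`6c` (`four_hops_or_progress`). Summing the advances and a final error of `2c d` gives `8c` and the
hopbound (`isHopset`).

Preservers. If `(z, r)` is a pivot pair or a first-group bunch pair, so is `(z', r)` for the next
vertex `z'` on a shortest path to `r`. Hence one stored successor per pair, in a perfect hash table,
lets a fixed program walk the path with constant time per edge
(`hasPathReportingPreserver_of_closed`). This closure needs the base to be all of `V`, which is why
it covers only `H₁` and `H₂`. -/

section ShortestPaths

/-! ### Shortest walks and successors on them. -/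

variable {V : Type*} {G : SimpleGraph V} {w : Sym2 V → ℝ≥0}

theorem walkWeight_nil (f : Sym2 V → ℝ≥0∞) (u : V) :
    walkWeight f (SimpleGraph.Walk.nil : G.Walk u u) = 0 := by
  simp [walkWeight]

theorem walkWeight_cons (f : Sym2 V → ℝ≥0∞) {u v x : V} (h : G.Adj u v) (p : G.Walk v x) :
    walkWeight f (SimpleGraph.Walk.cons h p) = f s(u, v) + walkWeight f p := by
  simp [walkWeight]

theorem walkWeight_append (f : Sym2 V → ℝ≥0∞) {u v x : V} (p : G.Walk u v) (q : G.Walk v x) :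
    walkWeight f (p.append q) = walkWeight f p + walkWeight f q := by
  simp [walkWeight]

theorem walkWeight_reverse (f : Sym2 V → ℝ≥0∞) {u v : V} (p : G.Walk u v) :
    walkWeight f p.reverse = walkWeight f p := by
  simp [walkWeight, List.sum_reverse]

theorem walkWeight_bypass_le [DecidableEq V] (f : Sym2 V → ℝ≥0∞) {u v : V} (p : G.Walk u v) :
    walkWeight f p.bypass ≤ walkWeight f p := by
  induction p with
  | nil => simp [SimpleGraph.Walk.bypass]
  | cons h p ih =>
    rw [SimpleGraph.Walk.bypass, walkWeight_cons]
    split_ifs with hs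
    · have := congrArg (walkWeight f) (p.bypass.take_spec hs)
      rw [walkWeight_append] at this
      calc _ ≤ walkWeight f p.bypass := this ▸ le_add_self
        _ ≤ _ := ih.trans le_add_self
    · rw [walkWeight_cons]
      gcongr

theorem graphDist_le {u v : V} (p : G.Walk u v) :
    graphDist G w u v ≤ walkWeight (fun e => (w e : ℝ≥0∞)) p :=
  iInf_le _ p

theorem graphDist_self (u : V) : graphDist G w u u = 0 :=
  le_antisymm ((graphDist_le SimpleGraph.Walk.nil).trans (walkWeight_nil _ u).le) zero_le

theorem graphDist_triangle (u v x : V) :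
    graphDist G w u x ≤ graphDist G w u v + graphDist G w v x := by
  refine ENNReal.le_iInf_add_iInf fun p q => ?_
  exact (graphDist_le (p.append q)).trans (walkWeight_append _ p q).le

theorem graphDist_le_of_adj {u v : V} (h : G.Adj u v) : graphDist G w u v ≤ w s(u, v) := by
  refine (graphDist_le (SimpleGraph.Walk.cons h SimpleGraph.Walk.nil)).trans ?_
  simp [walkWeight]

variable [Fintype V]

/-- Bypassing never increases the weight, so the infimum over all walks is one over finitely many
paths. -/
theorem exists_walk_eq_graphDist {u v : V} (h : graphDist G w u v ≠ ∞) :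
    ∃ p : G.Walk u v, walkWeight (fun e => (w e : ℝ≥0∞)) p = graphDist G w u v := by
  classical
  have hne : Nonempty (G.Walk u v) := by
    by_contra hc
    rw [not_nonempty_iff] at hc
    exact h (by simp [graphDist])
  have : Nonempty (G.Path u v) := hne.map fun p => p.toPath
  obtain ⟨p, hp⟩ := Finite.exists_min
    (fun p : G.Path u v => walkWeight (fun e => (w e : ℝ≥0∞)) p.1)
  refine ⟨p.1, le_antisymm (le_iInf fun q => ?_) (graphDist_le _)⟩
  exact (hp q.toPath).trans (walkWeight_bypass_le _ q)

/-- The least number of edges of a shortest walk from `z` to `r`. -/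
noncomputable def shortestHops (G : SimpleGraph V) (w : Sym2 V → ℝ≥0) (r z : V) : ℕ :=
  sInf {l | ∃ p : G.Walk z r,
    walkWeight (fun e => (w e : ℝ≥0∞)) p = graphDist G w z r ∧ p.length = l}

/-- Edges of weight zero may leave the distance to `r` unchanged, so the hop count serves as the
strictly decreasing measure. The successor is read off a shortest walk with fewest edges. -/
theorem exists_next_vertex {z r : V} (hzr : z ≠ r) (h : graphDist G w z r ≠ ∞) :
    ∃ y, G.Adj z y ∧ w s(z, y) + graphDist G w y r = graphDist G w z r ∧
      shortestHops G w r y < shortestHops G w r z := by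
  have hne : {l | ∃ p : G.Walk z r, walkWeight (fun e => (w e : ℝ≥0∞)) p = graphDist G w z r ∧
      p.length = l}.Nonempty :=
    let ⟨p, hp⟩ := exists_walk_eq_graphDist h
    ⟨_, p, hp, rfl⟩
  obtain ⟨p, hp, hl⟩ := Nat.sInf_mem hne
  change _ = shortestHops G w r z at hl
  cases p with
  | nil => exact absurd rfl hzr
  | @cons _ y _ hadj q =>
    rw [walkWeight_cons] at hp
    have h1 : graphDist G w z r ≤ w s(z, y) + graphDist G w y r :=
      (graphDist_triangle z y r).trans (by gcongr; exact graphDist_le_of_adj hadj)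
    have h2 := graphDist_le (w := w) q
    have h3 : (w s(z, y) : ℝ≥0∞) + graphDist G w y r = graphDist G w z r := by
      refine le_antisymm ?_ h1
      rw [← hp]
      gcongr
    refine ⟨y, hadj, h3, ?_⟩
    have h4 : walkWeight (fun e => (w e : ℝ≥0∞)) q = graphDist G w y r := by
      rw [← h3] at hp
      exact (ENNReal.add_right_inj ENNReal.coe_ne_top).1 hp
    have h5 : shortestHops G w r y ≤ q.length := Nat.sInf_le ⟨q, h4, rfl⟩
    rw [SimpleGraph.Walk.length_cons] at hl
    omega

open Classical in
/-- The vertex after `z` on a shortest path from `z` to `r`. -/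
noncomputable def nextVertex (G : SimpleGraph V) (w : Sym2 V → ℝ≥0) (r z : V) : V :=
  if h : z ≠ r ∧ graphDist G w z r ≠ ∞ then (exists_next_vertex h.1 h.2).choose else z

theorem nextVertex_spec {z r : V} (hzr : z ≠ r) (h : graphDist G w z r ≠ ∞) :
    G.Adj z (nextVertex G w r z) ∧
      w s(z, nextVertex G w r z) + graphDist G w (nextVertex G w r z) r = graphDist G w z r ∧
      shortestHops G w r (nextVertex G w r z) < shortestHops G w r z := by
  rw [nextVertex, dif_pos ⟨hzr, h⟩]
  exact (exists_next_vertex hzr h).choose_spec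

theorem graphDist_le_add_nextVertex {z r : V} (hzr : z ≠ r) (h : graphDist G w z r ≠ ∞) (x : V) :
    graphDist G w z x ≤ w s(z, nextVertex G w r z) + graphDist G w (nextVertex G w r z) x :=
  (graphDist_triangle z _ x).trans
    (by gcongr; exact graphDist_le_of_adj (nextVertex_spec hzr h).1)

/-- Crossing a threshold on a shortest path from `u` to `v`. -/
theorem exists_crossing_edge {u v : V} (h : graphDist G w u v ≠ ∞) {r : ℝ≥0∞}
    (hr : r < graphDist G w u v) :
    ∃ x y, G.Adj x y ∧ graphDist G w u x ≤ r ∧ r < graphDist G w u y ∧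
      graphDist G w u x + w s(x, y) = graphDist G w u y ∧
      graphDist G w u y + graphDist G w y v = graphDist G w u v := by
  -- Walk from `u` by successors towards `v`, keeping `z` on a shortest path from `u` and below the
  -- threshold.
  suffices H : ∀ N : ℕ, ∀ z, shortestHops G w v z ≤ N → graphDist G w u z ≤ r →
      graphDist G w u z + graphDist G w z v = graphDist G w u v →
      ∃ x y, G.Adj x y ∧ graphDist G w u x ≤ r ∧ r < graphDist G w u y ∧
      graphDist G w u x + w s(x, y) = graphDist G w u y ∧
      graphDist G w u y + graphDist G w y v = graphDist G w u v from
    H _ u le_rfl (by simp [graphDist_self]) (by simp [graphDist_self])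
  intro N
  induction N with
  | zero =>
    intro z hz hzr hzv
    have hne : z ≠ v := by rintro rfl; exact absurd hr hzr.not_gt
    have hf : graphDist G w z v ≠ ∞ := fun hc => h (by rw [← hzv, hc, add_top])
    have := (nextVertex_spec hne hf).2.2
    omega
  | succ N ih =>
    intro z hz hzr hzv
    have hne : z ≠ v := by rintro rfl; exact absurd hr hzr.not_gt
    have hf : graphDist G w z v ≠ ∞ := fun hc => h (by rw [← hzv, hc, add_top])
    obtain ⟨hadj, hd, hlt⟩ := nextVertex_spec hne hf
    set y := nextVertex G w v z
    have h1 : graphDist G w u y ≤ graphDist G w u z + w s(z, y) :=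
      (graphDist_triangle u z y).trans (by gcongr; exact graphDist_le_of_adj hadj)
    have h2 : graphDist G w u z + w s(z, y) + graphDist G w y v = graphDist G w u v := by
      rw [add_assoc, hd, hzv]
    have hyf : graphDist G w y v ≠ ∞ := fun hc => h (by rw [← h2, hc, add_top])
    have h3 : graphDist G w u y = graphDist G w u z + w s(z, y) := by
      refine le_antisymm h1 ?_
      refine (ENNReal.add_le_add_iff_right hyf).1 ?_
      rw [h2]
      exact graphDist_triangle u y v
    by_cases hy : graphDist G w u y ≤ r
    · exact ih y (by omega) hy (by rw [h3, h2])
    · exact ⟨z, y, hadj, hzr, not_le.1 hy, h3.symm, by rw [h3, h2]⟩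

end ShortestPaths

/-! ### Multiplicative hash functions with few collisions. -/

section PerfectHashing

open Finset

/-- The hash function `x ↦ ((a x) mod p) mod s`. -/
def hashValue (p a s x : ℕ) : ℕ := a * x % p % s

/-- The residues of `a x` and `a y` differ by `φ a` or by `φ a - p`, where `φ a = a (x - y) mod p`
is injective in `a`. A collision thus forces `s` to divide `φ a` or `p - φ a`. -/
theorem card_hash_collisions_of_lt {p s x y : ℕ} (hp : p.Prime) (hyx : y < x) (hx : x < p) :
    #{a ∈ Ioc 0 (p - 1) | hashValue p a s x = hashValue p a s y} ≤ 2 * ((p - 1) / s) := by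
  have hp0 := hp.pos
  set φ : ℕ → ℕ := fun a => a * (x - y) % p
  have hcop : Nat.Coprime (x - y) p :=
    (Nat.coprime_of_lt_prime (by omega) (by omega) hp).symm
  have hpos : ∀ a ∈ Ioc 0 (p - 1), 0 < φ a ∧ φ a < p := by
    intro a ha
    rw [mem_Ioc] at ha
    refine ⟨Nat.pos_of_ne_zero fun h0 => ?_, Nat.mod_lt _ hp0⟩
    have := (Nat.Coprime.dvd_of_dvd_mul_right hcop.symm (Nat.dvd_of_mod_eq_zero h0))
    have := Nat.le_of_dvd ha.1 this
    omega
  have hinj : Set.InjOn φ (Ioc 0 (p - 1) : Finset ℕ) := by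
    intro a ha b hb hab
    rw [mem_coe, mem_Ioc] at ha hb
    have h1 : a * (x - y) ≡ b * (x - y) [MOD p] := hab
    have h2 : a ≡ b [MOD p] := Nat.ModEq.cancel_right_of_coprime hcop.symm h1
    exact h2.eq_of_lt_of_lt (by omega) (by omega)
  set E₁ := {e ∈ Ioc 0 (p - 1) | s ∣ e}
  set E₂ := E₁.image (fun e => p - e)
  have hE₁ : #E₁ = (p - 1) / s := Nat.Ioc_filter_dvd_card_eq_div _ _
  have hE₂ : #E₂ ≤ (p - 1) / s := hE₁ ▸ card_image_le
  refine le_trans ?_ (show #(E₁ ∪ E₂) ≤ _ by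
    have := card_union_le E₁ E₂
    omega)
  refine card_le_card_of_injOn φ (fun a ha => ?_)
    (hinj.mono (by intro a ha; exact (mem_filter.1 ha).1))
  rw [mem_coe, mem_filter] at ha
  obtain ⟨ha, hcol⟩ := ha
  obtain ⟨h1, h2⟩ := hpos a ha
  have hsum : (a * y % p + φ a) % p = a * x % p := by
    rw [Nat.add_mod_mod, Nat.mod_add_mod, ← mul_add]
    congr 2
    omega
  have hylt : a * y % p < p := Nat.mod_lt _ hp0
  rw [mem_coe, mem_union]
  unfold hashValue at hcol
  rcases lt_or_ge (a * y % p + φ a) p with hlt | hge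
  · left
    rw [Nat.mod_eq_of_lt hlt] at hsum
    refine mem_filter.2 ⟨mem_Ioc.2 ⟨h1, by omega⟩, ?_⟩
    have := (Nat.modEq_iff_dvd' (show a * y % p ≤ a * x % p by omega)).1 hcol.symm
    rwa [show a * x % p - a * y % p = φ a by omega] at this
  · right
    rw [Nat.mod_eq_sub_mod hge, Nat.mod_eq_of_lt (by omega)] at hsum
    refine mem_image.2 ⟨p - φ a, mem_filter.2 ⟨mem_Ioc.2 ⟨by omega, by omega⟩, ?_⟩, by omega⟩
    have := (Nat.modEq_iff_dvd' (show a * x % p ≤ a * y % p by omega)).1 hcol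
    rwa [show a * y % p - a * x % p = p - φ a by omega] at this

theorem card_hash_collisions {p s x y : ℕ} (hp : p.Prime) (hxy : x ≠ y) (hx : x < p)
    (hy : y < p) :
    #{a ∈ Ioc 0 (p - 1) | hashValue p a s x = hashValue p a s y} ≤ 2 * ((p - 1) / s) := by
  rcases lt_or_gt_of_ne hxy with h | h
  · simp_rw [eq_comm (a := hashValue p _ s x)]
    exact card_hash_collisions_of_lt hp h hy
  · exact card_hash_collisions_of_lt hp h hx

/-- Some multiplier has few collisions. -/
theorem exists_few_collisions {p : ℕ} (hp : p.Prime) (s : ℕ) (K : Finset ℕ)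
    (hK : ∀ x ∈ K, x < p) :
    ∃ a < p, s * #{z ∈ K.offDiag | hashValue p a s z.1 = hashValue p a s z.2} ≤
      2 * #K.offDiag := by
  by_contra! hcon
  have hp1 := hp.one_lt
  -- Double counting: the average number of collisions over all multipliers is at most `2 *
  -- #K.offDiag / s`.
  have hsum : ∑ a ∈ Ioc 0 (p - 1), #{z ∈ K.offDiag | hashValue p a s z.1 = hashValue p a s z.2} ≤
      #K.offDiag * (2 * ((p - 1) / s)) := by
    simp_rw [card_filter]
    rw [sum_comm]
    simp_rw [← card_filter]
    rw [← smul_eq_mul]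
    refine sum_le_card_nsmul _ _ _ fun z hz => ?_
    rw [mem_offDiag] at hz
    exact card_hash_collisions hp hz.2.2 (hK _ hz.1) (hK _ hz.2.1)
  have hlow : ∑ a ∈ Ioc 0 (p - 1), (2 * #K.offDiag) <
      ∑ a ∈ Ioc 0 (p - 1),
        s * #{z ∈ K.offDiag | hashValue p a s z.1 = hashValue p a s z.2} := by
    refine sum_lt_sum_of_nonempty ⟨1, by rw [mem_Ioc]; omega⟩ fun a ha => hcon a ?_
    rw [mem_Ioc] at ha
    omega
  rw [sum_const, ← mul_sum, Nat.card_Ioc, smul_eq_mul, Nat.sub_zero] at hlow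
  have h1 := Nat.mul_le_mul_left s hsum
  have h2 : s * ((p - 1) / s) ≤ p - 1 := Nat.mul_div_le _ _
  have h3 : s * (#K.offDiag * (2 * ((p - 1) / s))) ≤ (p - 1) * (2 * #K.offDiag) := by
    calc _ = 2 * #K.offDiag * (s * ((p - 1) / s)) := by ring
      _ ≤ 2 * #K.offDiag * (p - 1) := Nat.mul_le_mul_left _ h2
      _ = _ := by ring
  omega

/-- With more than `2 * #K ^ 2` cells the average number of collisions is below one. -/
theorem exists_injective_hash {p : ℕ} (hp : p.Prime) (K : Finset ℕ) (hK : ∀ x ∈ K, x < p) :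
    ∃ a < p, ∀ x ∈ K, ∀ y ∈ K,
      hashValue p a (2 * #K ^ 2 + 1) x = hashValue p a (2 * #K ^ 2 + 1) y → x = y := by
  obtain ⟨a, ha, h⟩ := exists_few_collisions hp (2 * #K ^ 2 + 1) K hK
  refine ⟨a, ha, fun x hx y hy hxy => ?_⟩
  by_contra hne
  have hpos : 0 < #{z ∈ K.offDiag |
      hashValue p a (2 * #K ^ 2 + 1) z.1 = hashValue p a (2 * #K ^ 2 + 1) z.2} :=
    card_pos.2 ⟨(x, y), mem_filter.2 ⟨mem_offDiag.2 ⟨hx, hy, hne⟩, hxy⟩⟩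
  have h1 : #K.offDiag ≤ #K ^ 2 := by
    rw [offDiag_card, sq]
    omega
  have := Nat.mul_le_mul_left (2 * #K ^ 2 + 1) hpos
  omega

/-- The sum of squares counts ordered pairs with equal hash: at most `2 * #K` collisions and `#K`
diagonal pairs. It makes quadratic second-level tables linear in total. -/
theorem exists_hash_small_buckets {p : ℕ} (hp : p.Prime) (K : Finset ℕ) (hK : ∀ x ∈ K, x < p) :
    ∃ a < p, ∑ b ∈ range (#K + 1), #{x ∈ K | hashValue p a (#K + 1) x = b} ^ 2 ≤ 3 * #K := by
  obtain ⟨a, ha, h⟩ := exists_few_collisions hp (#K + 1) K hK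
  refine ⟨a, ha, ?_⟩
  set s := #K + 1
  set C := {z ∈ K.offDiag | hashValue p a s z.1 = hashValue p a s z.2}
  have hC : #C ≤ 2 * #K := by
    have h1 : #K.offDiag ≤ s * #K := by
      rw [offDiag_card]
      calc _ ≤ #K * #K := by omega
        _ ≤ _ := Nat.mul_le_mul_right _ (by omega)
    refine Nat.le_of_mul_le_mul_left (h.trans ?_) (show 0 < s by omega)
    calc _ ≤ 2 * (s * #K) := by omega
      _ = _ := by ring
  set P := {z ∈ K ×ˢ K | hashValue p a s z.1 = hashValue p a s z.2}
  have hP : #P ≤ #C + #K := by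
    have hsub : P ⊆ C ∪ K.diag := by
      intro z hz
      simp only [P, C, mem_filter, mem_product, mem_union, mem_offDiag, mem_diag] at hz ⊢
      tauto
    calc _ ≤ _ := card_le_card hsub
      _ ≤ #C + #K.diag := card_union_le _ _
      _ = _ := by rw [diag_card]
  have hfib : #P = ∑ b ∈ range s, #{z ∈ P | hashValue p a s z.1 = b} :=
    card_eq_sum_card_fiberwise fun z _ =>
      mem_coe.2 (mem_range.2 (Nat.mod_lt _ (by omega)))
  have heq : ∀ b ∈ range s, #{z ∈ P | hashValue p a s z.1 = b} =
      #{x ∈ K | hashValue p a s x = b} ^ 2 := by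
    intro b _
    rw [sq, ← card_product]
    congr 1
    ext z
    simp only [P, mem_filter, mem_product]
    constructor
    · rintro ⟨⟨⟨h1, h2⟩, h3⟩, h4⟩
      exact ⟨⟨h1, h4⟩, h2, h3 ▸ h4⟩
    · rintro ⟨⟨h1, h2⟩, h3, h4⟩
      exact ⟨⟨⟨h1, h3⟩, h2.trans h4.symm⟩, h2⟩
  rw [sum_congr rfl heq] at hfib
  omega

end PerfectHashing

/-! ### Static two-level hash tables of linear size. -/

section Dictionary

open Finset

/-- The cell of a two-level hash table `D` in which the key `x` is looked up. The entries `1`,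
`2` and `3` of `D` are the prime, the multiplier and the number of buckets of the first level;
the three entries for a bucket are the multiplier, the number of cells and the address of its
second level. -/
def cellAddress (D : List ℕ) (x : ℕ) : ℕ :=
  let b := hashValue (D.getD 1 0) (D.getD 2 0) (D.getD 3 0) x
  D.getD (3 * b + 6) 0 +
    2 * hashValue (D.getD 1 0) (D.getD (3 * b + 4) 0) (D.getD (3 * b + 5) 0) x

/-- The table `D` stores the values `val x` of the keys `x ∈ K`. -/
structure IsDictionary (D : List ℕ) (K : Finset ℕ) (val : ℕ → ℕ) : Prop where
  key : ∀ x ∈ K, D.getD (cellAddress D x) 0 = x + 1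
  value : ∀ x ∈ K, D.getD (cellAddress D x + 1) 0 = val x
  absent : ∀ x ∉ K, D.getD (cellAddress D x) 0 ≠ x + 1

theorem getD_map_range (f : ℕ → ℕ) (L i : ℕ) (hi : i < L) :
    ((List.range L).map f).getD i 0 = f i := by
  simp [List.getD, hi]

theorem exists_dictionary (n N : ℕ) (hN : 0 < N) (hn : n ≤ N) (K : Finset ℕ)
    (hK : ∀ x ∈ K, x < N) (val : ℕ → ℕ) (hval : ∀ x, val x < N) :
    ∃ D : List ℕ, D.length ≤ 20 * (#K + 1) ∧ (∀ x ∈ D, x < 20 * (N + 1)) ∧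
      D.getD 0 0 = n ∧ IsDictionary D K val := by
  classical
  obtain ⟨p, hp, hNp, hp2⟩ := Nat.exists_prime_lt_and_le_two_mul N hN.ne'
  have hKp : ∀ x ∈ K, x < p := fun x hx => (hK x hx).trans hNp
  obtain ⟨a, ha, hbuckets⟩ := exists_hash_small_buckets hp K hKp
  set s := #K + 1 with hs
  set bucket : ℕ → Finset ℕ := fun b => {x ∈ K | hashValue p a s x = b} with hbucket
  choose m hmp hminj using fun b => exists_injective_hash hp (bucket b)
    fun x hx => hKp x (mem_filter.1 hx).1
  set size : ℕ → ℕ := fun b => 2 * #(bucket b) ^ 2 + 1 with hsize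
  -- The table has four header words and three words per bucket, followed by the second-level cells
  -- of two words each.
  set off : ℕ → ℕ := fun b => 3 * s + 4 + 2 * ∑ i ∈ range b, size i with hoff
  set addr : ℕ → ℕ := fun x =>
    off (hashValue p a s x) + 2 * hashValue p (m (hashValue p a s x)) (size (hashValue p a s x)) x
    with haddr
  have hKN : #K ≤ N := by
    have := card_le_card (show K ⊆ range N from fun x hx => mem_range.2 (hK x hx))
    rwa [card_range] at this
  have hbs : ∀ x, hashValue p a s x < s := fun x => Nat.mod_lt _ (by omega)
  have hsecond : ∀ b x, hashValue p (m b) (size b) x < size b := fun b x =>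
    Nat.mod_lt _ (by simp only [hsize]; omega)
  change ∑ b ∈ range s, #(bucket b) ^ 2 ≤ 3 * #K at hbuckets
  have htotal : ∑ i ∈ range s, size i ≤ 7 * #K + 1 := by
    simp only [hsize, sum_add_distrib, ← mul_sum, sum_const, card_range, smul_eq_mul]
    omega
  have hoffmono : ∀ b b', b < b' → off b + 2 * size b ≤ off b' := by
    intro b b' hb
    have : ∑ i ∈ range (b + 1), size i ≤ ∑ i ∈ range b', size i :=
      sum_le_sum_of_subset (range_subset_range.2 hb)
    rw [sum_range_succ] at this
    simp only [hoff]
    omega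
  have hoffs : off s ≤ 17 * #K + 9 := by
    simp only [hoff]
    omega
  have haddr_lt : ∀ x, addr x + 1 < off s := by
    intro x
    have h1 := hoffmono _ _ (hbs x)
    have h2 := hsecond (hashValue p a s x) x
    simp only [haddr]
    omega
  have haddr_ge : ∀ x, 3 * s + 4 ≤ addr x := by
    intro x
    simp only [haddr, hoff]
    omega
  -- Cells start at even distance from `3 * s + 4`, so a key word is never read as a value word.
  have hparity : ∀ x y, addr x ≠ addr y + 1 := by
    intro x y
    simp only [haddr, hoff]
    omega
  have hinj : ∀ x ∈ K, ∀ y ∈ K, addr x = addr y → x = y := by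
    intro x hx y hy hxy
    have hx2 := hsecond (hashValue p a s x) x
    have hy2 := hsecond (hashValue p a s y) y
    rcases lt_trichotomy (hashValue p a s x) (hashValue p a s y) with hlt | heq | hlt
    · have := hoffmono _ _ hlt
      simp only [haddr] at hxy
      omega
    · refine hminj (hashValue p a s x) x (mem_filter.2 ⟨hx, rfl⟩) y
        (mem_filter.2 ⟨hy, heq.symm⟩) ?_
      simp only [haddr, ← heq] at hxy
      change hashValue p (m (hashValue p a s x)) (size (hashValue p a s x)) x =
        hashValue p (m (hashValue p a s x)) (size (hashValue p a s x)) y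
      omega
    · have := hoffmono _ _ hlt
      simp only [haddr] at hxy
      omega
  -- Keys are stored shifted by one, so the entry `0` of an unused cell matches no key.
  set f : ℕ → ℕ := fun i =>
    if i = 0 then n else if i = 1 then p else if i = 2 then a else if i = 3 then s
    else if i < 3 * s + 4 then
      if (i - 4) % 3 = 0 then m ((i - 4) / 3) else if (i - 4) % 3 = 1 then size ((i - 4) / 3)
      else off ((i - 4) / 3)
    else if h : ∃ x ∈ K, addr x = i then h.choose + 1
    else if h : ∃ x ∈ K, addr x + 1 = i then val h.choose else 0 with hf
  have hsize_lt : ∀ b < s, size b < 20 * (N + 1) := by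
    intro b hb
    have : size b ≤ ∑ i ∈ range s, size i :=
      single_le_sum (f := size) (fun _ _ => Nat.zero_le _) (mem_range.2 hb)
    omega
  have hoff_lt : ∀ b < s, off b < 20 * (N + 1) := by
    intro b hb
    have := hoffmono b s hb
    omega
  have hf_lt : ∀ i, f i < 20 * (N + 1) := by
    intro i
    simp only [hf]
    split_ifs with h0 h1 h2 h3 h4 h5 h6 h7 h8
    · omega
    · omega
    · omega
    · omega
    · have := hmp ((i - 4) / 3)
      omega
    · exact hsize_lt _ (by omega)
    · exact hoff_lt _ (by omega)
    · have := hK _ h7.choose_spec.1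
      omega
    · have := hval h8.choose
      omega
    · omega
  set D := (List.range (off s)).map f with hD
  have hos : 3 * s + 4 ≤ off s := by simp only [hoff]; omega
  have hget : ∀ i < off s, D.getD i 0 = f i := fun i hi => getD_map_range f _ i hi
  have g0 : D.getD 0 0 = n := by rw [hget 0 (by omega)]; simp [hf]
  have g1 : D.getD 1 0 = p := by rw [hget 1 (by omega)]; simp [hf]
  have g2 : D.getD 2 0 = a := by rw [hget 2 (by omega)]; simp [hf]
  have g3 : D.getD 3 0 = s := by rw [hget 3 (by omega)]; simp [hf]
  have g4 : ∀ b < s, D.getD (3 * b + 4) 0 = m b := by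
    intro b hb
    rw [hget _ (by omega)]
    simp only [hf]
    rw [if_neg (by omega), if_neg (by omega), if_neg (by omega), if_neg (by omega),
      if_pos (by omega), if_pos (by omega), show (3 * b + 4 - 4) / 3 = b by omega]
  have g5 : ∀ b < s, D.getD (3 * b + 5) 0 = size b := by
    intro b hb
    rw [hget _ (by omega)]
    simp only [hf]
    rw [if_neg (by omega), if_neg (by omega), if_neg (by omega), if_neg (by omega),
      if_pos (by omega), if_neg (by omega), if_pos (by omega),
      show (3 * b + 5 - 4) / 3 = b by omega]
  have g6 : ∀ b < s, D.getD (3 * b + 6) 0 = off b := by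
    intro b hb
    rw [hget _ (by omega)]
    simp only [hf]
    rw [if_neg (by omega), if_neg (by omega), if_neg (by omega), if_neg (by omega),
      if_pos (by omega), if_neg (by omega), if_neg (by omega),
      show (3 * b + 6 - 4) / 3 = b by omega]
  have hcell : ∀ x, cellAddress D x = addr x := by
    intro x
    simp only [cellAddress, g1, g2, g3, g4 _ (hbs x), g5 _ (hbs x), g6 _ (hbs x), haddr]
  have hfcell : ∀ i, 3 * s + 4 ≤ i → f i =
      if h : ∃ x ∈ K, addr x = i then h.choose + 1
      else if h : ∃ x ∈ K, addr x + 1 = i then val h.choose else 0 := by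
    intro i hi
    simp only [hf]
    rw [if_neg (by omega), if_neg (by omega), if_neg (by omega), if_neg (by omega),
      if_neg (by omega)]
  refine ⟨D, ?_, ?_, g0, ⟨fun x hx => ?_, fun x hx => ?_, fun x hx => ?_⟩⟩
  · simp only [hD, List.length_map, List.length_range]
    omega
  · intro x hx
    simp only [hD, List.mem_map] at hx
    obtain ⟨i, -, rfl⟩ := hx
    exact hf_lt i
  · rw [hcell, hget _ (by have := haddr_lt x; omega), hfcell _ (haddr_ge x)]
    have h : ∃ y ∈ K, addr y = addr x := ⟨x, hx, rfl⟩
    rw [dif_pos h, hinj _ h.choose_spec.1 x hx h.choose_spec.2]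
  · rw [hcell, hget _ (haddr_lt x), hfcell _ ((haddr_ge x).trans (by omega))]
    have h' : ¬ ∃ y ∈ K, addr y = addr x + 1 := fun ⟨y, _, hy⟩ => hparity _ _ hy
    have h : ∃ y ∈ K, addr y + 1 = addr x + 1 := ⟨x, hx, rfl⟩
    rw [dif_neg h', dif_pos h, hinj _ h.choose_spec.1 x hx (by have := h.choose_spec.2; omega)]
  · rw [hcell, hget _ (by have := haddr_lt x; omega), hfcell _ (haddr_ge x)]
    have h' : ¬ ∃ y ∈ K, addr y + 1 = addr x := fun ⟨y, _, hy⟩ => hparity _ _ hy.symm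
    by_cases h : ∃ y ∈ K, addr y = addr x
    · rw [dif_pos h]
      intro hc
      have : h.choose = x := by omega
      exact hx (this ▸ h.choose_spec.1)
    · rw [dif_neg h, dif_neg h']
      omega

end Dictionary

/-! ### Execution of straight-line code and table lookup. -/

section Machine

/-- The program `P`, started in `σ`, halts in `τ` after at most `t` steps. -/
def HaltsWithin (B : ℕ) (D : List ℕ) (P : RamProgram) (σ : RamState) (t : ℕ) (τ : RamState) :
    Prop :=
  ∃ s ≤ t, RamExec B D P σ s τ

variable {B : ℕ} {D : List ℕ}

theorem HaltsWithin.mono {P : RamProgram} {σ τ : RamState} {t t' : ℕ}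
    (h : HaltsWithin B D P σ t τ) (htt' : t ≤ t') : HaltsWithin B D P σ t' τ :=
  let ⟨s, hs, he⟩ := h
  ⟨s, hs.trans htt', he⟩

theorem HaltsWithin.seq {P Q : RamProgram} {σ τ υ : RamState} {t s : ℕ}
    (h₁ : HaltsWithin B D P σ t τ) (h₂ : HaltsWithin B D Q τ s υ) :
    HaltsWithin B D (.seq P Q) σ (t + s) υ :=
  let ⟨a, ha, hea⟩ := h₁
  let ⟨b, hb, heb⟩ := h₂
  ⟨a + b, by omega, .seq hea heb⟩

theorem HaltsWithin.cond_true {P Q : RamProgram} {r : ℕ} {σ τ : RamState} {t : ℕ}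
    (hr : σ.reg r ≠ 0) (h : HaltsWithin B D P σ t τ) :
    HaltsWithin B D (.cond r P Q) σ (1 + t) τ :=
  let ⟨a, ha, hea⟩ := h
  ⟨1 + a, by omega, .cond_true hr hea⟩

theorem HaltsWithin.cond_false {P Q : RamProgram} {r : ℕ} {σ τ : RamState} {t : ℕ}
    (hr : σ.reg r = 0) (h : HaltsWithin B D Q σ t τ) :
    HaltsWithin B D (.cond r P Q) σ (1 + t) τ :=
  let ⟨a, ha, hea⟩ := h
  ⟨1 + a, by omega, .cond_false hr hea⟩

theorem HaltsWithin.loop_done {P : RamProgram} {r : ℕ} {σ : RamState} (hr : σ.reg r = 0) :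
    HaltsWithin B D (.loop r P) σ 1 σ :=
  ⟨1, le_rfl, .loop_done hr⟩

theorem HaltsWithin.loop_step {P : RamProgram} {r : ℕ} {σ τ υ : RamState} {t s : ℕ}
    (hr : σ.reg r ≠ 0) (h₁ : HaltsWithin B D P σ t τ)
    (h₂ : HaltsWithin B D (.loop r P) τ s υ) :
    HaltsWithin B D (.loop r P) σ (1 + t + s) υ :=
  let ⟨a, ha, hea⟩ := h₁
  let ⟨b, hb, heb⟩ := h₂
  ⟨1 + a + b, by omega, .loop_step hr hea heb⟩

/-- The effect of an elementary instruction; control structures are ignored. -/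
def instructionEffect (B : ℕ) (D : List ℕ) (σ : RamState) : RamProgram → RamState
  | .const r a => { σ with reg := Function.update σ.reg r (a % B) }
  | .arith o r s t =>
      { σ with reg := Function.update σ.reg r (o.eval (σ.reg s) (σ.reg t) % B) }
  | .fetch r s => { σ with reg := Function.update σ.reg r (D.getD (σ.reg s) 0) }
  | .load r s => { σ with reg := Function.update σ.reg r (σ.work (σ.reg s)) }
  | .store r s => { σ with work := Function.update σ.work (σ.reg s) (σ.reg r) }
  | .emit r => { σ with output := σ.output ++ [σ.reg r] }
  | _ => σ

/-- Elementary instructions. -/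
def RamProgram.IsInstruction : RamProgram → Prop
  | .seq _ _ => False
  | .cond _ _ _ => False
  | .loop _ _ => False
  | _ => True

/-- Straight-line code. -/
def straightLine (l : List RamProgram) : RamProgram :=
  l.foldr .seq .skip

theorem ramExec_instruction {P : RamProgram} (hP : P.IsInstruction) (σ : RamState) :
    RamExec B D P σ 1 (instructionEffect B D σ P) := by
  cases P with
  | const r a => exact .const r a σ
  | arith o r s t => exact .arith o r s t σ
  | fetch r s => exact .fetch r s σ
  | load r s => exact .load r s σ
  | store r s => exact .store r s σ
  | emit r => exact .emit r σ
  | skip => exact .skip σ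
  | seq => exact hP.elim
  | cond => exact hP.elim
  | loop => exact hP.elim

theorem haltsWithin_straightLine (l : List RamProgram) (hl : ∀ P ∈ l, P.IsInstruction)
    (σ : RamState) :
    HaltsWithin B D (straightLine l) σ (l.length + 1) (l.foldl (instructionEffect B D) σ) := by
  induction l generalizing σ with
  | nil => exact ⟨1, le_rfl, .skip σ⟩
  | cons P l ih =>
    have h1 : HaltsWithin B D P σ 1 (instructionEffect B D σ P) :=
      ⟨1, le_rfl, ramExec_instruction (hl P (by simp)) σ⟩
    refine (h1.seq (ih (fun Q hQ => hl Q (by simp [hQ])) _)).mono ?_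
    simp only [List.length_cons]
    omega

/-- The instructions that look up the key `(reg x) * D[0] + reg y`: afterwards `reg 20` is zero
if and only if the key is present, and `reg 21` is its value. -/
def lookupCode (x y : ℕ) : List RamProgram :=
  [.const 10 0, .fetch 11 10, .arith .mul 12 x 11, .arith .add 12 12 y,
    .const 10 1, .fetch 13 10, .const 10 2, .fetch 14 10, .const 10 3, .fetch 15 10,
    .arith .mul 14 14 12, .arith .mod 14 14 13, .arith .mod 14 14 15, .arith .mul 14 10 14,
    .const 10 4, .arith .add 16 14 10, .fetch 16 16,
    .const 10 5, .arith .add 17 14 10, .fetch 17 17,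
    .const 10 6, .arith .add 18 14 10, .fetch 18 18,
    .arith .mul 16 16 12, .arith .mod 16 16 13, .arith .mod 16 16 17,
    .const 10 2, .arith .mul 16 10 16, .arith .add 18 18 16, .fetch 19 18,
    .const 10 1, .arith .add 12 12 10, .arith .add 18 18 10, .fetch 21 18,
    .arith .sub 20 12 19, .arith .sub 22 19 12, .arith .add 20 20 22]

/-- The data and the word size are large enough for `M`. -/
structure FitsWords (B M : ℕ) (D : List ℕ) : Prop where
  data : ∀ x ∈ D, x < M
  pos : 0 < M
  bound : 16 * M ^ 3 ≤ B

theorem FitsWords.getD_lt {M : ℕ} (h : FitsWords B M D) (i : ℕ) : D.getD i 0 < M := by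
  rcases lt_or_ge i D.length with hi | hi
  · rw [List.getD_eq_getElem _ _ hi]
    exact h.data _ (List.getElem_mem hi)
  · rw [List.getD_eq_default _ _ hi]
    exact h.pos

/-- Every intermediate value is a small multiple of `M ^ 3`, so no reduction modulo `B` takes
effect. Equality is tested by adding the two truncated differences. Registers below `10` survive the
lookup. -/
theorem lookup_foldl {M : ℕ} (hfit : FitsWords B M D) {x y : ℕ} (hx : x < 10) (hy : y < 10)
    (σ : RamState) (hxM : σ.reg x < M) (hyM : σ.reg y < M) :
    let τ := (lookupCode x y).foldl (instructionEffect B D) σ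
    let key := σ.reg x * D.getD 0 0 + σ.reg y
    τ.work = σ.work ∧ τ.output = σ.output ∧ (∀ r < 10, τ.reg r = σ.reg r) ∧
      (τ.reg 20 = 0 ↔ D.getD (cellAddress D key) 0 = key + 1) ∧
      τ.reg 21 = D.getD (cellAddress D key + 1) 0 := by
  intro τ key
  have hM3 := hfit.bound
  have hM := hfit.pos
  have hMM : M ^ 2 ≤ M ^ 3 := Nat.pow_le_pow_right hM (by norm_num)
  have hM1 : M ≤ M ^ 3 := Nat.le_self_pow (by norm_num) M
  have hg := hfit.getD_lt
  have hmul : σ.reg x * D.getD 0 0 + M ≤ M ^ 2 + M := by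
    have := Nat.mul_le_mul hxM.le (hg 0).le
    rw [← sq] at this
    omega
  have hkey : key ≤ M ^ 2 + M := by simp only [key]; omega
  have hprod : ∀ i, D.getD i 0 * key ≤ 2 * M ^ 3 := by
    intro i
    calc _ ≤ M * (M ^ 2 + M) := Nat.mul_le_mul (hg i).le hkey
      _ = M ^ 3 + M ^ 2 := by ring
      _ ≤ _ := by omega
  have hmod : ∀ i j, D.getD i 0 * key % D.getD j 0 ≤ 2 * M ^ 3 := fun i j =>
    (Nat.mod_le _ _).trans (hprod i)
  have hhash : ∀ i j l, D.getD i 0 * key % D.getD j 0 % D.getD l 0 ≤ 2 * M ^ 3 := fun i j l =>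
    (Nat.mod_le _ _).trans (hmod i j)
  have hx' : ∀ i, 10 ≤ i → x ≠ i := fun i hi => by omega
  have hy' : ∀ i, 10 ≤ i → y ≠ i := fun i hi => by omega
  have e1 : σ.reg x * D.getD 0 0 % B = σ.reg x * D.getD 0 0 := Nat.mod_eq_of_lt (by omega)
  have e2 : (σ.reg x * D.getD 0 0 + σ.reg y) % B = key := Nat.mod_eq_of_lt (by omega)
  have e3 : ∀ i, D.getD i 0 * key % B = D.getD i 0 * key := fun i =>
    Nat.mod_eq_of_lt (by have := hprod i; omega)
  have e4 : ∀ i j, D.getD i 0 * key % D.getD j 0 % B = D.getD i 0 * key % D.getD j 0 :=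
    fun i j => Nat.mod_eq_of_lt (by have := hmod i j; omega)
  have e5 : ∀ i j l, D.getD i 0 * key % D.getD j 0 % D.getD l 0 % B =
      D.getD i 0 * key % D.getD j 0 % D.getD l 0 :=
    fun i j l => Nat.mod_eq_of_lt (by have := hhash i j l; omega)
  set b := D.getD 2 0 * key % D.getD 1 0 % D.getD 3 0 with hb
  have hbB : b ≤ 2 * M ^ 3 := hhash 2 1 3
  have eb : b % B = b := Nat.mod_eq_of_lt (by omega)
  have e6 : 3 * b % B = 3 * b := Nat.mod_eq_of_lt (by omega)
  have e7 : ∀ i ≤ 6, (3 * b + i) % B = 3 * b + i := fun i hi => Nat.mod_eq_of_lt (by omega)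
  set h := D.getD (3 * b + 4) 0 * key % D.getD 1 0 % D.getD (3 * b + 5) 0 with hh
  have hhB : h ≤ 2 * M ^ 3 := hhash _ 1 _
  have eh : h % B = h := Nat.mod_eq_of_lt (by omega)
  have e8 : 2 * h % B = 2 * h := Nat.mod_eq_of_lt (by omega)
  have e9 : (D.getD (3 * b + 6) 0 + 2 * h) % B = D.getD (3 * b + 6) 0 + 2 * h :=
    Nat.mod_eq_of_lt (by have := hg (3 * b + 6); omega)
  have e10 : (D.getD (3 * b + 6) 0 + 2 * h + 1) % B = D.getD (3 * b + 6) 0 + 2 * h + 1 :=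
    Nat.mod_eq_of_lt (by have := hg (3 * b + 6); omega)
  have e11 : (key + 1) % B = key + 1 := Nat.mod_eq_of_lt (by omega)
  have hcell : cellAddress D key = D.getD (3 * b + 6) 0 + 2 * h := rfl
  have c0 : ∀ i ≤ 6, i % B = i := fun i hi => Nat.mod_eq_of_lt (by omega)
  have hst := hg (cellAddress D key)
  have e12 : ∀ i, i ≤ M ^ 2 + M + 1 → i % B = i := fun i hi => Nat.mod_eq_of_lt (by omega)
  refine ⟨rfl, rfl, fun r hr => ?_, ?_, ?_⟩
  · have hr' : ∀ i, 10 ≤ i → r ≠ i := fun i hi => by omega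
    simp [τ, lookupCode, instructionEffect, hr']
  · have : τ.reg 20 = ((key + 1 - D.getD (cellAddress D key) 0) % B +
        (D.getD (cellAddress D key) 0 - (key + 1)) % B) % B := by
      simp only [τ, lookupCode, instructionEffect, List.foldl_cons, List.foldl_nil, WordOp.eval,
        Function.update_apply, hx', hy', le_refl, Nat.reduceLeDiff, if_true, if_false, c0, e1, e2,
        e3, e4, ← hb, eb, e6, e7, ← hh, eh, e8, e9, e11, hcell, zero_le, Nat.reduceEqDiff]
    rw [this, e12 (key + 1 - _) (by omega), e12 (_ - (key + 1)) (by omega), e12 _ (by omega)]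
    omega
  · simp only [τ, lookupCode, instructionEffect, List.foldl_cons, List.foldl_nil, WordOp.eval,
      Function.update_apply, hx', hy', le_refl, Nat.reduceLeDiff, if_true, if_false, c0, e1, e2,
      e3, e4, ← hb, eb, e6, e7, ← hh, eh, e8, e9, e10, hcell, zero_le, Nat.reduceEqDiff]

end Machine

/-! ### The query program and its running time. -/

section WalkProgram

variable {B : ℕ} {D : List ℕ}

/-- Replace the vertex in `reg 2` by its successor on the way to the vertex in `reg t`;
afterwards `reg 3` is zero if and only if the target is reached. -/
def advanceCode (t : ℕ) : List RamProgram :=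
  -- Adding the zero in `reg 10` copies a register.
  lookupCode 2 t ++ [.const 10 0, .arith .add 2 21 10, .arith .sub 3 2 t, .arith .sub 22 t 2,
    .arith .add 3 3 22]

/-- The value which `D` stores for the key `z * D[0] + r`. -/
def storedNext (D : List ℕ) (r z : ℕ) : ℕ :=
  D.getD (cellAddress D (z * D.getD 0 0 + r) + 1) 0

theorem advance_foldl {M : ℕ} (hfit : FitsWords B M D) {t : ℕ} (ht : t < 2)
    (σ : RamState) (h2 : σ.reg 2 < M) (htM : σ.reg t < M) :
    let τ := (advanceCode t).foldl (instructionEffect B D) σ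
    τ.work = σ.work ∧ τ.output = σ.output ∧ (∀ r < 10, r ≠ 2 → r ≠ 3 → τ.reg r = σ.reg r) ∧
      τ.reg 2 = storedNext D (σ.reg t) (σ.reg 2) ∧ (τ.reg 3 = 0 ↔ τ.reg 2 = τ.reg t) := by
  intro τ
  obtain ⟨hw, ho, hr, -, hv⟩ := lookup_foldl hfit (show 2 < 10 by norm_num)
    (show t < 10 by omega) σ h2 htM
  have hτ : τ = ([.const 10 0, .arith .add 2 21 10, .arith .sub 3 2 t, .arith .sub 22 t 2,
    .arith .add 3 3 22] : List RamProgram).foldl (instructionEffect B D)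
    ((lookupCode 2 t).foldl (instructionEffect B D) σ) := by
    simp only [τ, advanceCode, List.foldl_append]
  set σ' := (lookupCode 2 t).foldl (instructionEffect B D) σ
  have ht' := hr t (by omega)
  have hb := hfit.bound
  have hM1 : M ≤ M ^ 3 := Nat.le_self_pow (by norm_num) M
  have hpos := hfit.pos
  have hnext : storedNext D (σ.reg t) (σ.reg 2) < M := hfit.getD_lt _
  have hlt : ∀ i < 2 * M, i % B = i := fun i hi => Nat.mod_eq_of_lt (by omega)
  change σ'.reg 21 = storedNext D (σ.reg t) (σ.reg 2) at hv
  have t2 : t ≠ 2 := by omega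
  have t3 : t ≠ 3 := by omega
  have t10 : t ≠ 10 := by omega
  have t22 : t ≠ 22 := by omega
  have hreg2 : τ.reg 2 = storedNext D (σ.reg t) (σ.reg 2) := by
    rw [hτ]
    simp [instructionEffect, WordOp.eval, hv,
      hlt (storedNext D (σ.reg t) (σ.reg 2)) (by omega)]
  have hregt : τ.reg t = σ.reg t := by
    rw [hτ]
    simp [instructionEffect, t2, t3, t10, t22, ht']
  refine ⟨?_, ?_, fun r h10 hr2 hr3 => ?_, hreg2, ?_⟩
  · rw [hτ, ← hw]; rfl
  · rw [hτ, ← ho]; rfl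
  · rw [hτ]
    have : r ≠ 10 := by omega
    have : r ≠ 22 := by omega
    simp [instructionEffect, *]
  · have : τ.reg 3 = ((storedNext D (σ.reg t) (σ.reg 2) - σ.reg t) % B +
        (σ.reg t - storedNext D (σ.reg t) (σ.reg 2)) % B) % B := by
      rw [hτ]
      simp [instructionEffect, WordOp.eval, hv, t2, t3, t10, ht',
        hlt (storedNext D (σ.reg t) (σ.reg 2)) (by omega)]
    rw [hreg2, hregt, this, hlt (storedNext D (σ.reg t) (σ.reg 2) - σ.reg t) (by omega),
      hlt (σ.reg t - _) (by omega), hlt _ (by omega)]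
    omega

/-- `Follows D r z l`: from `z` the stored successors lead along the list `l` to `r`. -/
inductive Follows (D : List ℕ) (r : ℕ) : ℕ → List ℕ → Prop
  | last : Follows D r r [r]
  | step {z : ℕ} {l : List ℕ} : z ≠ r → Follows D r (storedNext D r z) l → Follows D r z (z :: l)

theorem isInstruction_lookupCode {x y : ℕ} : ∀ P ∈ lookupCode x y, P.IsInstruction := by
  simp [lookupCode, RamProgram.IsInstruction]

theorem isInstruction_advanceCode {t : ℕ} : ∀ P ∈ advanceCode t, P.IsInstruction := by
  intro P hP
  rw [advanceCode, List.mem_append] at hP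
  rcases hP with hP | hP
  · exact isInstruction_lookupCode P hP
  · revert P
    simp [RamProgram.IsInstruction]

/-- Emit the vertices on the way from `reg 2` to `reg 1`, except the last one. -/
def forwardLoop : RamProgram :=
  .loop 3 (straightLine (.emit 2 :: advanceCode 1))

/-- The invariant is that the output followed by the current vertex is the part already walked; the
last vertex stays in `reg 2`. -/
theorem forwardLoop_halts {M : ℕ} (hfit : FitsWords B M D) {r z : ℕ} {l : List ℕ}
    (hl : Follows D r z l) (σ : RamState) (hr : r < M) (hz : z < M) (h1 : σ.reg 1 = r)
    (h2 : σ.reg 2 = z) (h3 : σ.reg 3 = 0 ↔ z = r) :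
    ∃ τ, HaltsWithin B D forwardLoop σ (50 * l.length) τ ∧
      τ.output ++ [τ.reg 2] = σ.output ++ l := by
  induction hl generalizing σ with
  | last =>
    exact ⟨σ, (HaltsWithin.loop_done (h3.2 rfl)).mono (by simp), by rw [h2]⟩
  | @step z l hzr hl ih =>
    have hbody := haltsWithin_straightLine (B := B) (D := D) (.emit 2 :: advanceCode 1)
      (by simpa [RamProgram.IsInstruction] using isInstruction_advanceCode) σ
    set σ₁ := instructionEffect B D σ (.emit 2)
    obtain ⟨-, ho, hr', hn, h3'⟩ := advance_foldl hfit (t := 1) (by norm_num) σ₁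
      (by simpa [σ₁, instructionEffect, h2] using hz)
      (by simpa [σ₁, instructionEffect, h1] using hr)
    rw [List.foldl_cons] at hbody
    set σ₂ := (advanceCode 1).foldl (instructionEffect B D) σ₁
    have e1 : σ₂.reg 1 = r := (hr' 1 (by norm_num) (by norm_num) (by norm_num)).trans h1
    have e2 : σ₂.reg 2 = storedNext D r z := by
      rw [hn, show σ₁.reg 1 = r from h1, show σ₁.reg 2 = z from h2]
    obtain ⟨τ, hτ, hout⟩ := ih σ₂ (hfit.getD_lt _) e1 e2 (by rw [h3', e1, e2])
    refine ⟨τ, (HaltsWithin.loop_step (fun h0 => hzr (h3.1 h0)) hbody hτ).mono ?_, ?_⟩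
    · simp [advanceCode, lookupCode]
      omega
    · rw [hout, ho, ← h2]
      simp [σ₁, instructionEffect]

/-- Write the vertices on the way from `reg 2` to `reg 0`, except the last one, to the working
memory, and count them in `reg 4`. -/
def backwardLoop : RamProgram :=
  .loop 3 (straightLine
    (.store 2 4 :: .const 10 1 :: .arith .add 4 4 10 :: advanceCode 0))

/-- As in the forward loop, with the walked part in working memory. The bound on `reg 4 + l.length`
keeps the counter from wrapping around. -/
theorem backwardLoop_halts {M : ℕ} (hfit : FitsWords B M D) {r z : ℕ} {l : List ℕ}
    (hl : Follows D r z l) (σ : RamState) (hr : r < M) (hz : z < M) (h0 : σ.reg 0 = r)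
    (h2 : σ.reg 2 = z) (h3 : σ.reg 3 = 0 ↔ z = r) (h4 : σ.reg 4 + l.length ≤ M + 1) :
    ∃ τ, HaltsWithin B D backwardLoop σ (60 * l.length) τ ∧ τ.output = σ.output ∧
      τ.reg 4 + 1 = σ.reg 4 + l.length ∧
      (List.range (τ.reg 4)).map τ.work ++ [τ.reg 2] =
        (List.range (σ.reg 4)).map σ.work ++ l := by
  induction hl generalizing σ with
  | last =>
    exact ⟨σ, (HaltsWithin.loop_done (h3.2 rfl)).mono (by simp), rfl, by simp, by rw [h2]⟩
  | @step z l hzr hl ih =>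
    have hbody := haltsWithin_straightLine (B := B) (D := D)
      (.store 2 4 :: .const 10 1 :: .arith .add 4 4 10 :: advanceCode 0)
      (by simpa [RamProgram.IsInstruction] using isInstruction_advanceCode) σ
    rw [List.foldl_cons, List.foldl_cons, List.foldl_cons] at hbody
    set σ₁ := instructionEffect B D (instructionEffect B D (instructionEffect B D σ
      (.store 2 4)) (.const 10 1)) (.arith .add 4 4 10) with hσ₁
    have hb := hfit.bound
    have hM1 : M ≤ M ^ 3 := Nat.le_self_pow (by norm_num) M
    have hpos := hfit.pos
    have a0 : σ₁.reg 0 = r := by simp [σ₁, instructionEffect, h0]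
    have a2 : σ₁.reg 2 = z := by simp [σ₁, instructionEffect, h2]
    have a4 : σ₁.reg 4 = σ.reg 4 + 1 := by
      rw [List.length_cons] at h4
      simp only [hσ₁, instructionEffect, Function.update_self, WordOp.eval]
      rw [Function.update_of_ne (by norm_num), Nat.mod_eq_of_lt (show 1 < B by omega),
        Nat.mod_eq_of_lt (by omega)]
    have aw : σ₁.work = Function.update σ.work (σ.reg 4) z := by
      simp [σ₁, instructionEffect, h2]
    obtain ⟨hw, ho, hr', hn, h3'⟩ := advance_foldl hfit (t := 0) (by norm_num) σ₁
      (a2 ▸ hz) (a0 ▸ hr)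
    set σ₂ := (advanceCode 0).foldl (instructionEffect B D) σ₁
    have e0 : σ₂.reg 0 = r := (hr' 0 (by norm_num) (by norm_num) (by norm_num)).trans a0
    have e4 : σ₂.reg 4 = σ.reg 4 + 1 :=
      (hr' 4 (by norm_num) (by norm_num) (by norm_num)).trans a4
    have e2 : σ₂.reg 2 = storedNext D r z := by rw [hn, a0, a2]
    rw [List.length_cons] at h4
    obtain ⟨τ, hτ, hout, hcount, hmem⟩ := ih σ₂ (hfit.getD_lt _) e0 e2 (by rw [h3', e0, e2])
      (by omega)
    refine ⟨τ, (HaltsWithin.loop_step (fun h => hzr (h3.1 h)) hbody hτ).mono ?_, ?_, ?_, ?_⟩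
    · simp [advanceCode, lookupCode]
      omega
    · rw [hout, ho]
      rfl
    · rw [hcount, e4, List.length_cons]
      omega
    · rw [hmem, e4, hw, aw, List.range_succ, List.map_append, List.map_singleton,
        Function.update_self, List.append_assoc, List.singleton_append]
      congr 1
      refine List.map_congr_left fun i hi => Function.update_of_ne ?_ _ _
      exact (List.mem_range.1 hi).ne

/-- Emit the first `reg 4` entries of the working memory in reverse order. -/
def emitLoop : RamProgram :=
  .loop 4 (straightLine [.const 10 1, .arith .sub 4 4 10, .load 5 4, .emit 5])

theorem emitLoop_halts (hB : 1 < B) (i : ℕ) (hi : i < B) (σ : RamState) (h4 : σ.reg 4 = i) :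
    ∃ τ, HaltsWithin B D emitLoop σ (6 * i + 1) τ ∧
      τ.output = σ.output ++ ((List.range i).map σ.work).reverse := by
  induction i generalizing σ with
  | zero => exact ⟨σ, HaltsWithin.loop_done h4, by simp⟩
  | succ i ih =>
    have hbody := haltsWithin_straightLine (B := B) (D := D)
      [.const 10 1, .arith .sub 4 4 10, .load 5 4, .emit 5]
      (by simp [RamProgram.IsInstruction]) σ
    set σ₁ := List.foldl (instructionEffect B D) σ
      [.const 10 1, .arith .sub 4 4 10, .load 5 4, .emit 5] with hσ₁
    have e1 : 1 % B = 1 := Nat.mod_eq_of_lt hB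
    have e2 : i % B = i := Nat.mod_eq_of_lt (by omega)
    have a4 : σ₁.reg 4 = i := by
      simp [σ₁, instructionEffect, WordOp.eval, h4, e1, e2]
    have aw : σ₁.work = σ.work := rfl
    have ao : σ₁.output = σ.output ++ [σ.work i] := by
      simp [σ₁, instructionEffect, WordOp.eval, h4, e1, e2]
    obtain ⟨τ, hτ, hout⟩ := ih (by omega) σ₁ a4
    refine ⟨τ, (HaltsWithin.loop_step (by omega) hbody hτ).mono ?_, ?_⟩
    · simp
      omega
    · rw [hout, ao, aw, List.range_succ]
      simp

/-- The query program: if the key of `(u, v)` is present, follow the stored successors from `u`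
to `v`; otherwise follow them from `v` to `u` and report the reversed list. -/
def pathQuery : RamProgram :=
  .seq (straightLine (lookupCode 0 1)) (.cond 20
    (.seq (straightLine [.const 10 0, .arith .add 2 1 10, .arith .sub 3 1 0,
        .arith .sub 22 0 1, .arith .add 3 3 22])
      (.seq backwardLoop (.seq (.emit 2) emitLoop)))
    (.seq (straightLine [.const 10 0, .arith .add 2 0 10, .arith .sub 3 0 1,
        .arith .sub 22 1 0, .arith .add 3 3 22])
      (.seq forwardLoop (.emit 2))))

/-- The key `key` is present in the table `D`. -/
def KeyPresent (D : List ℕ) (key : ℕ) : Prop :=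
  D.getD (cellAddress D key) 0 = key + 1

theorem Follows.length_pos {r z : ℕ} {l : List ℕ} (h : Follows D r z l) : 0 < l.length := by
  cases h <;> simp

theorem answers_forward {M : ℕ} (hfit : FitsWords B M D) {u v : ℕ} (hu : u < M) (hv : v < M)
    (hkey : KeyPresent D (u * D.getD 0 0 + v)) {l : List ℕ} (hl : Follows D v u l) :
    Answers B pathQuery D u v l (100 * l.length) := by
  have hlook := haltsWithin_straightLine (B := B) (D := D) (lookupCode 0 1)
    isInstruction_lookupCode (queryState u v)
  obtain ⟨-, ho, hr, hk, -⟩ := lookup_foldl hfit (x := 0) (y := 1) (by norm_num) (by norm_num)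
    (queryState u v) hu hv
  set σ₁ := (lookupCode 0 1).foldl (instructionEffect B D) (queryState u v)
  have hstart := haltsWithin_straightLine (B := B) (D := D)
    [.const 10 0, .arith .add 2 0 10, .arith .sub 3 0 1, .arith .sub 22 1 0, .arith .add 3 3 22]
    (by simp [RamProgram.IsInstruction]) σ₁
  set σ₂ := List.foldl (instructionEffect B D) σ₁
    [.const 10 0, .arith .add 2 0 10, .arith .sub 3 0 1, .arith .sub 22 1 0, .arith .add 3 3 22]
  have a0 : σ₁.reg 0 = u := hr 0 (by norm_num)
  have a1 : σ₁.reg 1 = v := hr 1 (by norm_num)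
  have hb := hfit.bound
  have hM1 : M ≤ M ^ 3 := Nat.le_self_pow (by norm_num) M
  have hpos := hfit.pos
  have hlt : ∀ i < 2 * M, i % B = i := fun i hi => Nat.mod_eq_of_lt (by omega)
  have e1 : σ₂.reg 1 = v := by simp [σ₂, instructionEffect, a1]
  have e2 : σ₂.reg 2 = u := by
    simp [σ₂, instructionEffect, WordOp.eval, a0, hlt u (by omega)]
  have e3 : σ₂.reg 3 = 0 ↔ u = v := by
    have : σ₂.reg 3 = u - v + (v - u) := by
      simp [σ₂, instructionEffect, WordOp.eval, a0, a1, hlt (u - v) (by omega),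
        hlt (v - u) (by omega), hlt (u - v + (v - u)) (by omega)]
    omega
  obtain ⟨τ, hτ, hout⟩ := forwardLoop_halts hfit hl σ₂ hv hu e1 e2 e3
  have hemit : HaltsWithin B D (.emit 2) τ 1 (instructionEffect B D τ (.emit 2)) :=
    ⟨1, le_rfl, .emit 2 τ⟩
  obtain ⟨s, hs, hexec⟩ := hlook.seq (HaltsWithin.cond_false (P :=
    .seq (straightLine [.const 10 0, .arith .add 2 1 10, .arith .sub 3 1 0,
        .arith .sub 22 0 1, .arith .add 3 3 22])
      (.seq backwardLoop (.seq (.emit 2) emitLoop))) (hk.2 hkey) (hstart.seq (hτ.seq hemit)))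
  refine ⟨s, _, hexec, hs.trans ?_, ?_⟩
  · have := hl.length_pos
    simp [lookupCode]
    omega
  · change τ.output ++ [τ.reg 2] = l
    rw [hout, show σ₂.output = [] from ho]
    rfl

theorem answers_backward {M : ℕ} (hfit : FitsWords B M D) {u v : ℕ} (hu : u < M) (hv : v < M)
    (hkey : ¬ KeyPresent D (u * D.getD 0 0 + v)) {l : List ℕ} (hl : Follows D u v l)
    (hlen : l.length ≤ M) :
    Answers B pathQuery D u v l.reverse (120 * l.length) := by
  have hlook := haltsWithin_straightLine (B := B) (D := D) (lookupCode 0 1)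
    isInstruction_lookupCode (queryState u v)
  obtain ⟨-, ho, hr, hk, -⟩ := lookup_foldl hfit (x := 0) (y := 1) (by norm_num) (by norm_num)
    (queryState u v) hu hv
  set σ₁ := (lookupCode 0 1).foldl (instructionEffect B D) (queryState u v)
  have hstart := haltsWithin_straightLine (B := B) (D := D)
    [.const 10 0, .arith .add 2 1 10, .arith .sub 3 1 0, .arith .sub 22 0 1, .arith .add 3 3 22]
    (by simp [RamProgram.IsInstruction]) σ₁
  set σ₂ := List.foldl (instructionEffect B D) σ₁
    [.const 10 0, .arith .add 2 1 10, .arith .sub 3 1 0, .arith .sub 22 0 1, .arith .add 3 3 22]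
  have a0 : σ₁.reg 0 = u := hr 0 (by norm_num)
  have a1 : σ₁.reg 1 = v := hr 1 (by norm_num)
  have a4 : σ₁.reg 4 = 0 := hr 4 (by norm_num)
  have hb := hfit.bound
  have hM1 : M ≤ M ^ 3 := Nat.le_self_pow (by norm_num) M
  have hpos := hfit.pos
  have hlt : ∀ i < 2 * M, i % B = i := fun i hi => Nat.mod_eq_of_lt (by omega)
  have e0 : σ₂.reg 0 = u := by simp [σ₂, instructionEffect, a0]
  have e4 : σ₂.reg 4 = 0 := by simp [σ₂, instructionEffect, a4]
  have e2 : σ₂.reg 2 = v := by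
    simp [σ₂, instructionEffect, WordOp.eval, a1, hlt v (by omega)]
  have e3 : σ₂.reg 3 = 0 ↔ v = u := by
    have : σ₂.reg 3 = v - u + (u - v) := by
      simp [σ₂, instructionEffect, WordOp.eval, a0, a1, hlt (u - v) (by omega),
        hlt (v - u) (by omega), hlt (v - u + (u - v)) (by omega)]
    omega
  obtain ⟨τ, hτ, hout, hcount, hmem⟩ :=
    backwardLoop_halts hfit hl σ₂ hu hv e0 e2 e3 (by omega)
  have hemit : HaltsWithin B D (.emit 2) τ 1 (instructionEffect B D τ (.emit 2)) :=
    ⟨1, le_rfl, .emit 2 τ⟩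
  obtain ⟨υ, hυ, hυout⟩ := emitLoop_halts (B := B) (D := D) (by omega) (τ.reg 4) (by omega)
    (instructionEffect B D τ (.emit 2)) rfl
  obtain ⟨s, hs, hexec⟩ := hlook.seq (HaltsWithin.cond_true (Q :=
    .seq (straightLine [.const 10 0, .arith .add 2 0 10, .arith .sub 3 0 1,
        .arith .sub 22 1 0, .arith .add 3 3 22])
      (.seq forwardLoop (.emit 2))) (fun h => hkey (hk.1 h))
    (hstart.seq (hτ.seq (hemit.seq hυ))))
  refine ⟨s, _, hexec, hs.trans ?_, ?_⟩
  · have := hl.length_pos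
    simp [lookupCode]
    omega
  · rw [e4] at hmem
    have : l = (List.range (τ.reg 4)).map τ.work ++ [τ.reg 2] := by rw [hmem]; rfl
    rw [hυout, this, List.reverse_append]
    have ho2 : σ₂.output = [] := ho
    simp [instructionEffect, hout, ho2]

end WalkProgram

/-! ### Preservers for families of pairs closed under successors. -/

section Preserver

variable {n : ℕ}

/-- For `W = 2 ^ (log n + 1)` one has `16 ≤ W ^ 4` and `20 * (n ^ 2 + 1) ≤ W ^ 7`, whence the
exponent `25 = 4 + 3 * 7`. -/
theorem fitsWords_wordBound (hn : 0 < n) {D : List ℕ} (hD : ∀ x ∈ D, x < 20 * (n ^ 2 + 1)) :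
    FitsWords (wordBound 25 n) (20 * (n ^ 2 + 1)) D := by
  refine ⟨hD, by positivity, ?_⟩
  set W := 2 ^ (Nat.log 2 n + 1) with hW
  have h1 : n + 1 ≤ W := Nat.lt_pow_succ_log_self (by norm_num) n
  have h2 : 2 ≤ W := by omega
  have h3 : 2 ^ 5 ≤ W ^ 5 := Nat.pow_le_pow_left h2 5
  have h4 : 2 ^ 4 ≤ W ^ 4 := Nat.pow_le_pow_left h2 4
  have h5 : n ^ 2 + 1 ≤ W ^ 2 := by nlinarith
  have h6 : 20 * (n ^ 2 + 1) ≤ W ^ 7 := by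
    calc _ ≤ 2 ^ 5 * W ^ 2 := by omega
      _ ≤ W ^ 5 * W ^ 2 := Nat.mul_le_mul_right _ h3
      _ = _ := by ring
  calc _ ≤ W ^ 4 * (W ^ 7) ^ 3 := Nat.mul_le_mul h4 (Nat.pow_le_pow_left h6 3)
    _ = wordBound 25 n := by rw [wordBound, mul_comm 25, pow_mul, ← hW]; ring

theorem pair_code_inj {x y x' y' : Fin n} (h : x.val * n + y.val = x'.val * n + y'.val) :
    x = x' ∧ y = y' := by
  have h1 := congrArg (· / n) h
  have h2 := congrArg (· % n) h
  have hn := y.pos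
  simp only [Nat.mul_add_mod_of_lt, Fin.is_lt] at h2
  rw [Nat.mul_comm, Nat.mul_comm x'.val] at h1
  simp only [Nat.mul_add_div hn, Nat.div_eq_of_lt y.isLt, Nat.div_eq_of_lt y'.isLt] at h1
  exact ⟨Fin.ext (by omega), Fin.ext h2⟩

variable {G : SimpleGraph (Fin n)} {w : Sym2 (Fin n) → ℝ≥0}

/-- The edges from `z` towards `r` on the chosen shortest path, for the pairs `(z, r)` of `R`. -/
noncomputable def nextEdges (G : SimpleGraph (Fin n)) (w : Sym2 (Fin n) → ℝ≥0)
    (R : Finset (Fin n × Fin n)) : Finset (Sym2 (Fin n)) :=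
  R.image fun x => s(x.1, nextVertex G w x.2 x.1)

theorem fromEdgeSet_nextEdges_le {R : Finset (Fin n × Fin n)}
    (hfin : ∀ x ∈ R, graphDist G w x.1 x.2 ≠ ∞) :
    SimpleGraph.fromEdgeSet (nextEdges G w R : Set (Sym2 (Fin n))) ≤ G := by
  rw [← SimpleGraph.edgeSet_subset_edgeSet]
  intro e he
  rw [SimpleGraph.edgeSet_fromEdgeSet] at he
  obtain ⟨he, hd⟩ := he
  obtain ⟨x, hx, rfl⟩ := Finset.mem_image.1 (Finset.mem_coe.1 he)
  -- For `z = r` the default value of `nextVertex` is `z`; that pair contributes a loop, which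
  -- `fromEdgeSet` discards.
  have hne : x.1 ≠ x.2 := by
    intro h
    apply hd
    rw [nextVertex, dif_neg (by simp [h])]
    exact Sym2.mk_isDiag_iff.2 rfl
  exact (nextVertex_spec hne (hfin x hx)).1

/-- Closure keeps every intermediate pair in the table. The hop counts to `r` strictly decrease
along the walk, so no vertex repeats. -/
theorem exists_followed_path {R : Finset (Fin n × Fin n)}
    (hfin : ∀ x ∈ R, graphDist G w x.1 x.2 ≠ ∞)
    (hclosed : ∀ x ∈ R, x.1 ≠ x.2 → (nextVertex G w x.2 x.1, x.2) ∈ R) {D : List ℕ}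
    (hD : ∀ x ∈ R, storedNext D x.2 x.1 = nextVertex G w x.2 x.1) (r : Fin n) (N : ℕ) :
    ∀ z, (z, r) ∈ R → shortestHops G w r z ≤ N →
      ∃ p : (SimpleGraph.fromEdgeSet (nextEdges G w R : Set (Sym2 (Fin n)))).Walk z r,
        p.IsPath ∧ walkWeight (fun e => (w e : ℝ≥0∞)) p = graphDist G w z r ∧
        Follows D r z (p.support.map Fin.val) ∧
        ∀ x ∈ p.support, shortestHops G w r x ≤ shortestHops G w r z := by
  have hnil : ∃ p : (SimpleGraph.fromEdgeSet (nextEdges G w R : Set (Sym2 (Fin n)))).Walk r r,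
        p.IsPath ∧ walkWeight (fun e => (w e : ℝ≥0∞)) p = graphDist G w r r ∧
        Follows D r r (p.support.map Fin.val) ∧
        ∀ x ∈ p.support, shortestHops G w r x ≤ shortestHops G w r r :=
    ⟨.nil, .nil, by rw [walkWeight_nil, graphDist_self], by simpa using Follows.last, by simp⟩
  induction N with
  | zero =>
    intro z hz hN
    by_cases hzr : z = r
    · subst hzr; exact hnil
    · have := (nextVertex_spec hzr (hfin _ hz)).2.2
      omega
  | succ N ih =>
    intro z hz hN
    by_cases hzr : z = r
    · subst hzr; exact hnil
    · obtain ⟨hadj, hd, hlt⟩ := nextVertex_spec hzr (hfin _ hz)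
      obtain ⟨p, hp, hwt, hfol, hsup⟩ := ih _ (hclosed _ hz hzr) (by simp only; omega)
      have hS : (SimpleGraph.fromEdgeSet (nextEdges G w R : Set (Sym2 (Fin n)))).Adj z
          (nextVertex G w r z) :=
        (SimpleGraph.fromEdgeSet_adj _).2
          ⟨Finset.mem_coe.2 (Finset.mem_image.2 ⟨(z, r), hz, rfl⟩), hadj.ne⟩
      refine ⟨.cons hS p, ?_, ?_, ?_, ?_⟩
      · refine (SimpleGraph.Walk.cons_isPath_iff _ _).2 ⟨hp, fun hmem => ?_⟩
        have := hsup z hmem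
        simp only at this
        omega
      · rw [walkWeight_cons, hwt, ← hd]
      · rw [SimpleGraph.Walk.support_cons, List.map_cons]
        refine Follows.step (fun h => hzr (Fin.ext h)) ?_
        rw [hD _ hz]
        exact hfol
      · intro x hx
        rw [SimpleGraph.Walk.support_cons, List.mem_cons] at hx
        rcases hx with rfl | hx
        · exact le_rfl
        · exact (hsup x hx).trans hlt.le

/-- A family of pairs `(z, r)` that is closed under moving `z` towards `r` along shortest paths
has a path-reporting preserver of linear size. -/
theorem hasPathReportingPreserver_of_closed (hn : 0 < n) (R : Finset (Fin n × Fin n))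
    (hfin : ∀ x ∈ R, graphDist G w x.1 x.2 ≠ ∞)
    (hclosed : ∀ x ∈ R, x.1 ≠ x.2 → (nextVertex G w x.2 x.1, x.2) ∈ R)
    (H : Finset (Sym2 (Fin n))) (hH : ∀ e ∈ H, ∃ x ∈ R, s(x.1, x.2) = e) {m : ℝ}
    (hm : 20 * ((R.card : ℝ) + 1) ≤ m) :
    HasPathReportingPreserver pathQuery 25 120 G w H m := by
  set K : Finset ℕ := R.image fun x => x.1.val * n + x.2.val
  set val : ℕ → ℕ := fun key =>
    if h : key / n < n then (nextVertex G w ⟨key % n, Nat.mod_lt _ hn⟩ ⟨key / n, h⟩).val else 0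
    with hval
  have hnn : n ≤ n ^ 2 := Nat.le_self_pow (by norm_num) n
  have hcode : ∀ x y : Fin n, x.val * n + y.val < n ^ 2 := by
    intro x y
    calc _ < x.val * n + n := by omega
      _ = (x.val + 1) * n := by ring
      _ ≤ n * n := Nat.mul_le_mul_right _ x.isLt
      _ = _ := by ring
  obtain ⟨D, hlen, hbound, h0, hdict⟩ := exists_dictionary n (n ^ 2) (by positivity) hnn K
    (by
      intro x hx
      obtain ⟨y, -, rfl⟩ := Finset.mem_image.1 hx
      exact hcode _ _) val
    (by
      intro x
      simp only [hval]
      split_ifs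
      · exact lt_of_lt_of_le (Fin.is_lt _) hnn
      · positivity)
  have hK : ∀ x y : Fin n, x.val * n + y.val ∈ K ↔ (x, y) ∈ R := by
    intro x y
    constructor
    · intro h
      obtain ⟨z, hz, he⟩ := Finset.mem_image.1 h
      obtain ⟨h1, h2⟩ := pair_code_inj he
      rwa [← h1, ← h2]
    · exact fun h => Finset.mem_image.2 ⟨(x, y), h, rfl⟩
  have hstored : ∀ x ∈ R, storedNext D x.2 x.1 = nextVertex G w x.2 x.1 := by
    rintro ⟨z, r⟩ hx
    rw [storedNext, h0, hdict.value _ ((hK z r).2 hx)]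
    have h1 : (z.val * n + r.val) / n = z.val := by
      rw [mul_comm, Nat.mul_add_div hn, Nat.div_eq_of_lt r.isLt, add_zero]
    have h2 : (z.val * n + r.val) % n = r.val := Nat.mul_add_mod_of_lt r.isLt
    simp only [hval, h1, h2, Fin.is_lt, dif_pos, Fin.eta]
  have hfit := fitsWords_wordBound hn hbound
  have hlt : ∀ x : Fin n, x.val < 20 * (n ^ 2 + 1) := fun x => by omega
  refine ⟨SimpleGraph.fromEdgeSet (nextEdges G w R : Set (Sym2 (Fin n))), D,
    ⟨fromEdgeSet_nextEdges_le hfin, fun x hx => (hbound x hx).trans_le ?_, ?_⟩, ?_⟩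
  · have h1 := hfit.bound
    have h2 : 20 * (n ^ 2 + 1) ≤ (20 * (n ^ 2 + 1)) ^ 3 := Nat.le_self_pow (by norm_num) _
    omega
  · intro u v huv
    have huv' : s(u, v) ∈ H := huv
    -- An unordered pair may be stored in one orientation only; in the other case the path is walked
    -- from `v` and reversed.
    by_cases hR : (u, v) ∈ R
    · obtain ⟨p, hp, hwt, hfol, -⟩ := exists_followed_path hfin hclosed hstored v _ u hR le_rfl
      refine ⟨p, hp, by rw [hwt, one_mul], ?_⟩
      have hkey : KeyPresent D (u.val * D.getD 0 0 + v.val) := by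
        rw [h0]
        exact hdict.key _ ((hK u v).2 hR)
      obtain ⟨s, τ, he, hs, ho⟩ := answers_forward hfit (hlt u) (hlt v) hkey hfol
      refine ⟨s, τ, he, hs.trans ?_, ho⟩
      rw [List.length_map, SimpleGraph.Walk.length_support]
      omega
    · have hR' : (v, u) ∈ R := by
        obtain ⟨x, hx, he⟩ := hH _ huv'
        rcases Sym2.eq_iff.1 he with ⟨h1, h2⟩ | ⟨h1, h2⟩
        · exact absurd (by rwa [← h1, ← h2]) hR
        · rwa [← h1, ← h2]
      obtain ⟨p, hp, hwt, hfol, -⟩ := exists_followed_path hfin hclosed hstored u _ v hR' le_rfl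
      refine ⟨p.reverse, hp.reverse, by
        rw [walkWeight_reverse, hwt, one_mul, graphDist_comm], ?_⟩
      have hkey : ¬ KeyPresent D (u.val * D.getD 0 0 + v.val) := by
        rw [h0]
        exact hdict.absent _ fun h => hR ((hK u v).1 h)
      -- A path has fewer than `n` edges, so the list fits into the counter range of the backward
      -- loop.
      have hlp := hp.length_lt
      rw [Fintype.card_fin] at hlp
      obtain ⟨s, τ, he, hs, ho⟩ := answers_backward hfit (hlt u) (hlt v) hkey hfol (by
        rw [List.length_map, SimpleGraph.Walk.length_support]
        omega)
      refine ⟨s, τ, he, hs.trans ?_, ?_⟩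
      · rw [List.length_map, SimpleGraph.Walk.length_support, SimpleGraph.Walk.length_reverse]
        omega
      · rw [ho, SimpleGraph.Walk.support_reverse, List.map_reverse]
  · refine le_trans ?_ hm
    have h1 : (SimpleGraph.fromEdgeSet (nextEdges G w R : Set (Sym2 (Fin n)))).edgeSet.ncard ≤
        R.card := by
      rw [SimpleGraph.edgeSet_fromEdgeSet]
      calc _ ≤ (nextEdges G w R : Set (Sym2 (Fin n))).ncard :=
            Set.ncard_le_ncard Set.sdiff_subset (Finset.finite_toSet _)
        _ = (nextEdges G w R).card := Set.ncard_coe_finset _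
        _ ≤ _ := Finset.card_image_le
    have h2 : K.card ≤ R.card := Finset.card_image_le
    have h3 : spannerSize (SimpleGraph.fromEdgeSet (nextEdges G w R : Set (Sym2 (Fin n)))) D ≤
        20 * (R.card + 1) := by
      rw [spannerSize]
      exact max_le (by omega) (by omega)
    exact_mod_cast h3

end Preserver

/-! ### Existence of good samples by averaging. -/

section Sampling

open Finset

/-- A geometric series over ranks. Ties only raise ranks, which shrinks the powers; an element of
maximal value has rank `#A`. -/
theorem sum_pow_rank_le {ι α : Type*} [DecidableEq ι] [LinearOrder α] (f : ι → α) {x : ℝ}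
    (hx0 : 0 ≤ x) (hx1 : x ≤ 1) (A : Finset ι) :
    (1 - x) * ∑ v ∈ A, x ^ #{a ∈ A | f a ≤ f v} ≤ 1 - x ^ #A := by
  induction A using Finset.induction_on_max_value f with
  | empty => simp
  | insert a s ha hmax ih =>
    rw [sum_insert ha, card_insert_of_notMem ha]
    have h1 : {b ∈ insert a s | f b ≤ f a} = insert a s :=
      filter_true_of_mem fun b hb => by
        rcases mem_insert.1 hb with rfl | hb
        · exact le_rfl
        · exact hmax b hb
    rw [h1, card_insert_of_notMem ha]
    have h2 : ∑ v ∈ s, x ^ #{b ∈ insert a s | f b ≤ f v} ≤ ∑ v ∈ s, x ^ #{b ∈ s | f b ≤ f v} :=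
      sum_le_sum fun v _ => pow_le_pow_of_le_one hx0 hx1
        (card_le_card (filter_subset_filter _ (subset_insert _ _)))
    have h3 := mul_le_mul_of_nonneg_left h2 (sub_nonneg.2 hx1)
    have h4 : 0 ≤ x ^ #s * ((1 - x) * (1 - x)) := by
      have := sub_nonneg.2 hx1
      positivity
    rw [pow_succ]
    linarith

variable {V : Type*}

section Weights

variable [DecidableEq V]

/-- The probability of `S` when every element of `A` is sampled with probability `q`. -/
noncomputable def sampleWeight (q : ℝ) (A S : Finset V) : ℝ :=
  q ^ #S * (1 - q) ^ #(A \ S)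

/-- Expand the product over `a ∈ A` of `q + (1 - q)`, with `q` replaced by `0` on `T`. -/
theorem sum_sampleWeight_disjoint (q : ℝ) {A T : Finset V} (hT : T ⊆ A) :
    ∑ S ∈ A.powerset, sampleWeight q A S * (if Disjoint S T then 1 else 0) =
      (1 - q) ^ #T := by
  have h := Finset.prod_add (fun a => if a ∈ T then 0 else q) (fun _ => 1 - q) A
  have h1 : ∏ a ∈ A, ((if a ∈ T then 0 else q) + (1 - q)) = (1 - q) ^ #T := by
    calc _ = ∏ a ∈ A, (if a ∈ T then 1 - q else 1) := by
          refine prod_congr rfl fun a _ => ?_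
          split_ifs <;> ring
      _ = _ := by
          rw [prod_ite_mem, inter_eq_right.2 hT, prod_const]
  rw [← h1, h]
  refine sum_congr rfl fun S _ => ?_
  rw [prod_const, sampleWeight]
  split_ifs with hd
  · rw [mul_one]
    congr 1
    rw [← prod_const]
    refine prod_congr rfl fun a ha => ?_
    rw [if_neg (disjoint_left.1 hd ha)]
  · rw [not_disjoint_iff] at hd
    obtain ⟨a, haS, haT⟩ := hd
    rw [mul_zero, prod_eq_zero haS (by rw [if_pos haT]), zero_mul]

theorem sum_sampleWeight (q : ℝ) (A : Finset V) :
    ∑ S ∈ A.powerset, sampleWeight q A S = 1 := by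
  simpa using sum_sampleWeight_disjoint q (empty_subset A)

theorem sum_sampleWeight_card (q : ℝ) (A : Finset V) :
    ∑ S ∈ A.powerset, sampleWeight q A S * #S = q * #A := by
  have h1 : ∀ S ∈ A.powerset, sampleWeight q A S * #S =
      ∑ a ∈ A, (sampleWeight q A S -
        sampleWeight q A S * (if Disjoint S {a} then 1 else 0)) := by
    intro S hS
    rw [mem_powerset] at hS
    simp_rw [← mul_one_sub]
    rw [← mul_sum]
    congr 1
    calc (#S : ℝ) = ∑ a ∈ A, (if a ∈ S then 1 else 0) := by
          rw [sum_ite_mem, inter_eq_right.2 hS, sum_const, nsmul_eq_mul, mul_one]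
      _ = _ := by
          refine sum_congr rfl fun a _ => ?_
          by_cases ha : a ∈ S <;> simp [ha]
  rw [sum_congr rfl h1, sum_comm]
  have h2 : ∀ a ∈ A, ∑ S ∈ A.powerset, (sampleWeight q A S -
        sampleWeight q A S * (if Disjoint S {a} then 1 else 0)) = q := by
    intro a ha
    rw [sum_sub_distrib, sum_sampleWeight,
      sum_sampleWeight_disjoint q (singleton_subset_iff.2 ha), card_singleton]
    ring
  rw [sum_congr rfl h2, sum_const, nsmul_eq_mul, mul_comm]

end Weights

open Classical in
/-- The vertices of `A` at finite distance from `u` that are nearer to `u` than `S` is. -/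
noncomputable def bunch (G : SimpleGraph V) (w : Sym2 V → ℝ≥0) (A S : Finset V) (u : V) :
    Finset V :=
  {v ∈ A | graphDist G w u v ≠ ∞ ∧ ∀ a ∈ S, graphDist G w u v < graphDist G w u a}

theorem mem_bunch {G : SimpleGraph V} {w : Sym2 V → ℝ≥0} {A S : Finset V} {u v : V} :
    v ∈ bunch G w A S u ↔ v ∈ A ∧ graphDist G w u v ≠ ∞ ∧
      ∀ a ∈ S, graphDist G w u v < graphDist G w u a := by
  classical
  rw [bunch, mem_filter]

variable [DecidableEq V] (G : SimpleGraph V) (w : Sym2 V → ℝ≥0)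

/-- If `v` is in the bunch of `u`, the sample misses every vertex of `A` no farther from `u` than
`v`. This has probability `(1 - q)` to the rank of `v`, and the ranks sum geometrically to at most
`1 / q`. -/
theorem sum_sampleWeight_bunch {q : ℝ} (hq0 : 0 ≤ q) (hq1 : q ≤ 1) (A : Finset V) (u : V) :
    q * ∑ S ∈ A.powerset, sampleWeight q A S * #(bunch G w A S u) ≤ 1 := by
  set near : V → Finset V := fun v => {a ∈ A | graphDist G w u a ≤ graphDist G w u v}
  have hwt : ∀ S, 0 ≤ sampleWeight q A S := fun S => by
    have := sub_nonneg.2 hq1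
    unfold sampleWeight
    positivity
  have h1 : ∑ S ∈ A.powerset, sampleWeight q A S * #(bunch G w A S u) ≤
      ∑ v ∈ A, (1 - q) ^ #(near v) := by
    calc _ ≤ ∑ S ∈ A.powerset, ∑ v ∈ A,
          sampleWeight q A S * (if Disjoint S (near v) then 1 else 0) := by
          refine sum_le_sum fun S hS => ?_
          rw [mem_powerset] at hS
          rw [← mul_sum]
          refine mul_le_mul_of_nonneg_left ?_ (hwt S)
          rw [← sum_filter, sum_const, nsmul_eq_mul, mul_one]
          refine Nat.cast_le.2 (card_le_card fun v hv => ?_)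
          rw [mem_bunch] at hv
          refine mem_filter.2 ⟨hv.1, disjoint_left.2 fun a haS ha => ?_⟩
          exact (hv.2.2 a haS).not_ge (mem_filter.1 ha).2
      _ = _ := by
          rw [sum_comm]
          exact sum_congr rfl fun v _ => sum_sampleWeight_disjoint q (filter_subset _ _)
  have h2 := sum_pow_rank_le (graphDist G w u) (sub_nonneg.2 hq1) (by linarith : 1 - q ≤ 1) A
  have h3 := mul_le_mul_of_nonneg_left h1 hq0
  have h4 : 0 ≤ (1 - q) ^ #A := pow_nonneg (sub_nonneg.2 hq1) _
  rw [sub_sub_cancel] at h2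
  linarith

/-- Some sample is small and has small bunches on average. -/
theorem exists_sample {U A : Finset V} (hAU : A ⊆ U) {q : ℝ} (hq0 : 0 < q) (hq1 : q ≤ 1) :
    ∃ S ⊆ A, (#S : ℝ) ≤ q * #A ∧ q * ∑ u ∈ U, (#(bunch G w A S u) : ℝ) ≤ 4 * #U := by
  rcases A.eq_empty_or_nonempty with rfl | hne
  · exact ⟨∅, subset_rfl, by simp, by simp [bunch]⟩
  have hApos : (0 : ℝ) < #A := by exact_mod_cast hne.card_pos
  have hUpos : (0 : ℝ) < #U := by exact_mod_cast (hne.mono hAU).card_pos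
  set p := q / 2 with hp
  have hp0 : 0 < p := by positivity
  have hp1 : 0 < 1 - p := by linarith
  -- Both terms have expectation at most `p * #A * #U`, so a sample of at most average cost controls
  -- both at once. Losing the factor two in each is why `p = q / 2`.
  set cost : Finset V → ℝ := fun S =>
    #S * #U + p ^ 2 * #A * ∑ u ∈ U, (#(bunch G w A S u) : ℝ)
  have hsum : ∑ S ∈ A.powerset, sampleWeight p A S * cost S ≤
      ∑ S ∈ A.powerset, sampleWeight p A S * (2 * p * #A * #U) := by
    have e1 : ∑ S ∈ A.powerset, sampleWeight p A S * cost S =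
        (∑ S ∈ A.powerset, sampleWeight p A S * #S) * #U + p * #A *
          ∑ u ∈ U, p * ∑ S ∈ A.powerset, sampleWeight p A S * #(bunch G w A S u) := by
      simp_rw [mul_sum]
      rw [sum_comm (s := U), sum_mul, ← sum_add_distrib]
      refine sum_congr rfl fun S _ => ?_
      simp only [cost, mul_add, mul_sum]
      congr 1
      · ring
      · refine sum_congr rfl fun u _ => ?_
        ring
    have e2 : ∑ u ∈ U, p * ∑ S ∈ A.powerset, sampleWeight p A S * #(bunch G w A S u) ≤ #U := by
      calc _ ≤ ∑ u ∈ U, (1 : ℝ) :=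
            sum_le_sum fun u _ => sum_sampleWeight_bunch G w hp0.le (by linarith) A u
        _ = _ := by rw [sum_const, nsmul_eq_mul, mul_one]
    have e3 := mul_le_mul_of_nonneg_left e2 (show 0 ≤ p * (#A : ℝ) by positivity)
    rw [e1, sum_sampleWeight_card, ← sum_mul, sum_sampleWeight]
    linarith
  obtain ⟨S, hS, hle⟩ := exists_le_of_sum_le (powerset_nonempty A) hsum
  have hw0 : 0 < sampleWeight p A S := by unfold sampleWeight; positivity
  have hcost : cost S ≤ 2 * p * #A * #U := le_of_mul_le_mul_left hle hw0
  have hB : 0 ≤ ∑ u ∈ U, (#(bunch G w A S u) : ℝ) :=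
    sum_nonneg fun _ _ => Nat.cast_nonneg _
  have hSU : 0 ≤ (#S : ℝ) * #U := mul_nonneg (Nat.cast_nonneg _) hUpos.le
  refine ⟨S, mem_powerset.1 hS, ?_, ?_⟩
  · refine le_of_mul_le_mul_right ?_ hUpos
    have := mul_nonneg (mul_nonneg (sq_nonneg p) hApos.le) hB
    have h2 : 2 * p = q := by rw [hp]; ring
    rw [h2] at hcost
    simp only [cost] at hcost
    linarith
  · have h1 : p * #A * (p * ∑ u ∈ U, (#(bunch G w A S u) : ℝ)) ≤ p * #A * (2 * #U) := by
      have e : p * #A * (p * ∑ u ∈ U, (#(bunch G w A S u) : ℝ)) =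
          p ^ 2 * #A * ∑ u ∈ U, (#(bunch G w A S u) : ℝ) := by ring
      simp only [cost] at hcost
      rw [e]
      linarith
    have h2 := le_of_mul_le_mul_left h1 (by positivity)
    rw [hp] at h2
    linarith

/-- A hierarchy of samples; the bunches of level `i` are taken over the set at the beginning of
the group of `c` levels to which `i` belongs. -/
theorem exists_hierarchy [Fintype V] (c : ℕ) (q : ℕ → ℝ)
    (hq0 : ∀ i, 0 < q i) (hq1 : ∀ i, q i ≤ 1) :
    ∃ A : ℕ → Finset V, A 0 = univ ∧ (∀ i, A (i + 1) ⊆ A i) ∧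
      (∀ i, (#(A (i + 1)) : ℝ) ≤ q i * #(A i)) ∧
      ∀ i, q i * ∑ u ∈ A (i / c * c), (#(bunch G w (A i) (A (i + 1)) u) : ℝ) ≤
        4 * #(A (i / c * c)) := by
  have hnext : ∀ (i : ℕ) (P : {P : Finset V × Finset V // P.2 ⊆ P.1}), ∃ S ⊆ P.1.2,
      (#S : ℝ) ≤ q i * #P.1.2 ∧ q i * ∑ u ∈ P.1.1, (#(bunch G w P.1.2 S u) : ℝ) ≤ 4 * #P.1.1 :=
    fun i P => exists_sample G w P.2 (hq0 i) (hq1 i)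
  choose next hsub hcard hbunch using hnext
  -- The state is the base of the current group and the current level; the base is renewed whenever
  -- `c` divides the new index.
  let pairs : ℕ → {P : Finset V × Finset V // P.2 ⊆ P.1} := fun i =>
    Nat.rec ⟨(univ, univ), subset_rfl⟩ (fun i P =>
      if c ∣ i + 1 then ⟨(next i P, next i P), subset_rfl⟩
      else ⟨(P.1.1, next i P), (hsub i P).trans P.2⟩) i
  have hstep : ∀ i, pairs (i + 1) = if c ∣ i + 1 then ⟨(next i (pairs i), next i (pairs i)),
      subset_rfl⟩ else ⟨((pairs i).1.1, next i (pairs i)), (hsub i (pairs i)).trans (pairs i).2⟩ :=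
    fun i => rfl
  have hsnd : ∀ i, (pairs (i + 1)).1.2 = next i (pairs i) := by
    intro i
    rw [hstep]
    split_ifs <;> rfl
  have hfst : ∀ i, (pairs i).1.1 = (pairs (i / c * c)).1.2 := by
    intro i
    induction i with
    | zero => simp [pairs]
    | succ i ih =>
      by_cases hd : c ∣ i + 1
      · rw [Nat.div_mul_cancel hd, hsnd, hstep, if_pos hd]
      · rw [Nat.succ_div_of_not_dvd hd, ← ih, hstep, if_neg hd]
  refine ⟨fun i => (pairs i).1.2, rfl, fun i => ?_, fun i => ?_, fun i => ?_⟩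
  · simp only [hsnd]
    exact hsub _ _
  · simp only [hsnd]
    exact hcard _ _
  · simp only [hsnd, ← hfst]
    exact hbunch _ _

end Sampling

/-! ### Hop-bounded distances in `G ∪ H`. -/

section HopDistance

variable {V : Type*} [DecidableEq V] {G : SimpleGraph V} {w : Sym2 V → ℝ≥0} {H : Finset (Sym2 V)}

theorem hopDist_mono {a b : ℕ} (hab : a ≤ b) (u v : V) :
    hopDist G w H b u v ≤ hopDist G w H a u v :=
  le_iInf₂ fun p hp => iInf₂_le p (hp.trans hab)

theorem hopDist_self (a : ℕ) (u : V) : hopDist G w H a u u = 0 := by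
  refine le_antisymm ((iInf₂_le SimpleGraph.Walk.nil (Nat.zero_le _)).trans ?_) zero_le
  rw [walkWeight_nil]

theorem hopDist_triangle (a b : ℕ) (u v x : V) :
    hopDist G w H (a + b) u x ≤ hopDist G w H a u v + hopDist G w H b v x := by
  unfold hopDist
  simp only [ENNReal.iInf_add, ENNReal.add_iInf]
  refine le_iInf₂ fun p hp => le_iInf₂ fun q hq => ?_
  rw [← walkWeight_append]
  refine iInf₂_le _ ?_
  rw [SimpleGraph.Walk.length_append]
  omega

theorem hopDist_le_of_adj {u v : V} (h : (addPairs G H).Adj u v) :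
    hopDist G w H 1 u v ≤ addPairsWeight G w H s(u, v) := by
  refine (iInf₂_le (SimpleGraph.Walk.cons h .nil) (by simp)).trans ?_
  rw [walkWeight_cons, walkWeight_nil, add_zero]

theorem hopDist_le_graphDist {u v : V} (h : u = v ∨ s(u, v) ∈ H) :
    hopDist G w H 1 u v ≤ graphDist G w u v := by
  rcases eq_or_ne u v with rfl | hne
  · rw [hopDist_self]
    exact zero_le
  · have hH := h.resolve_left hne
    have hadj : (addPairs G H).Adj u v :=
      Or.inr ((SimpleGraph.fromEdgeSet_adj _).2 ⟨Finset.mem_coe.2 hH, hne⟩)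
    refine (hopDist_le_of_adj hadj).trans ?_
    rw [addPairsWeight, if_pos hH]
    exact le_rfl

/-- An edge of `G` that lies in `H` is reweighted by the distance, which is no larger. -/
theorem hopDist_le_weight {u v : V} (h : G.Adj u v) : hopDist G w H 1 u v ≤ w s(u, v) := by
  refine (hopDist_le_of_adj (Or.inl h)).trans ?_
  rw [addPairsWeight]
  split_ifs
  · exact graphDist_le_of_adj h
  · exact le_rfl

end HopDistance

/-! ### Stretch and hopbound from a hierarchy. -/

section Hopset

variable {V : Type*} [DecidableEq V]

/-- `H` contains the pivots and the bunches of the hierarchy `A` with `F` levels, where the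
bunches of level `i` are formed by the vertices of `A (i / c * c)`. -/
structure ContainsHierarchy (G : SimpleGraph V) (w : Sym2 V → ℝ≥0) (H : Finset (Sym2 V))
    (A : ℕ → Finset V) (c F : ℕ) : Prop where
  pivot : ∀ i < F, ∀ u, ∀ a ∈ A i, graphDist G w u a ≠ ∞ → ∃ p ∈ A i, (u = p ∨ s(u, p) ∈ H) ∧
    ∀ b ∈ A i, graphDist G w u p ≤ graphDist G w u b
  bunch : ∀ i < F, ∀ u ∈ A (i / c * c), ∀ v ∈ bunch G w (A i) (A (i + 1)) u,
    u = v ∨ s(u, v) ∈ H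

variable {G : SimpleGraph V} {w : Sym2 V → ℝ≥0} {H : Finset (Sym2 V)} {A : ℕ → Finset V}
  {c F : ℕ}

/-- Let `p` be the pivot of `x`. If `p` is in the bunch of `y`, the hops `x, p, y` weigh at most
`(2r+1) D`; otherwise some vertex of `A (i + 1)` is at least as near to `y` as `p` is. The summand
`D` on the left is the spare room used by the outer hops in `four_hops_or_near`. -/
theorem ContainsHierarchy.near_next_level (h : ContainsHierarchy G w H A c F) {i : ℕ}
    (hi : i < F) {x y : V} (hy : y ∈ A (i / c * c)) {D : ℝ≥0∞} (hD : D ≠ ∞)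
    (hxy : graphDist G w x y ≤ D) {r : ℕ} (hx : ∃ a ∈ A i, graphDist G w x a ≤ r * D) :
    hopDist G w H 2 x y + D ≤ 2 * (r + 1 : ℕ) * D ∨
      ∃ a ∈ A (i + 1), graphDist G w y a ≤ (r + 1 : ℕ) * D := by
  obtain ⟨a, ha, hxa⟩ := hx
  have hrD : (r : ℝ≥0∞) * D ≠ ∞ := ENNReal.mul_ne_top (ENNReal.natCast_ne_top r) hD
  obtain ⟨p, hp, hpH, hmin⟩ := h.pivot i hi x a ha (ne_top_of_le_ne_top hrD hxa)
  have hxp : graphDist G w x p ≤ r * D := (hmin a ha).trans hxa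
  have hyp : graphDist G w y p ≤ (r + 1 : ℕ) * D := by
    refine (graphDist_triangle y x p).trans ?_
    rw [graphDist_comm G w y x]
    calc _ ≤ D + r * D := add_le_add hxy hxp
      _ = _ := by push_cast; ring
  by_cases hb : p ∈ _root_.bunch G w (A i) (A (i + 1)) y
  · left
    have hpy : hopDist G w H 1 p y ≤ graphDist G w y p := by
      rw [graphDist_comm G w y p]
      refine hopDist_le_graphDist ?_
      rw [eq_comm, Sym2.eq_swap]
      exact h.bunch i hi y hy p hb
    calc hopDist G w H 2 x y + D ≤ hopDist G w H 1 x p + hopDist G w H 1 p y + D := by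
          gcongr
          exact hopDist_triangle 1 1 x p y
      _ ≤ r * D + (r + 1 : ℕ) * D + D := by
          gcongr
          · exact (hopDist_le_graphDist hpH).trans hxp
          · exact hpy.trans hyp
      _ = _ := by push_cast; ring
  · right
    rw [mem_bunch] at hb
    push Not at hb
    obtain ⟨b, hbA, hle⟩ := hb hp (ne_top_of_le_ne_top
      (ENNReal.mul_ne_top (ENNReal.natCast_ne_top _) hD) hyp)
    exact ⟨b, hbA, hle.trans hyp⟩

/-- `near_next_level` is applied in both directions at each level, so both endpoints climb together
as long as two hops fail. Only the base of the group matters, since `m ≤ c`. -/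
theorem ContainsHierarchy.two_hops_or_near (h : ContainsHierarchy G w H A c F) {j m : ℕ}
    (hm : m ≤ c) (hF : j * c + m ≤ F) {x y : V} (hx : x ∈ A (j * c)) (hy : y ∈ A (j * c))
    {D : ℝ≥0∞} (hD : D ≠ ∞) (hxy : graphDist G w x y ≤ D) :
    hopDist G w H 2 x y + D ≤ 2 * m * D ∨
      ((∃ a ∈ A (j * c + m), graphDist G w x a ≤ m * D) ∧
        ∃ a ∈ A (j * c + m), graphDist G w y a ≤ m * D) := by
  by_contra hcon
  rw [not_or] at hcon
  obtain ⟨hhop, hnear⟩ := hcon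
  have hhop' : ∀ i < m, ¬ hopDist G w H 2 x y + D ≤ 2 * (i + 1 : ℕ) * D := by
    intro i hi hle
    refine hhop (hle.trans ?_)
    gcongr
    exact hi
  refine hnear ?_
  suffices hind : ∀ i ≤ m, (∃ a ∈ A (j * c + i), graphDist G w x a ≤ i * D) ∧
      ∃ a ∈ A (j * c + i), graphDist G w y a ≤ i * D from hind m le_rfl
  intro i
  induction i with
  | zero => exact fun _ => ⟨⟨x, hx, by simp [graphDist_self]⟩, ⟨y, hy, by simp [graphDist_self]⟩⟩
  | succ i ih =>
    intro hi
    obtain ⟨h1, h2⟩ := ih (by omega)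
    have hbase : (j * c + i) / c * c = j * c := by
      rw [mul_comm j, Nat.mul_add_div (by omega), Nat.div_eq_of_lt (by omega), add_zero, mul_comm]
    have hlt : j * c + i < F := by omega
    rw [← hbase] at hx hy
    have hyx : graphDist G w y x ≤ D := graphDist_comm G w x y ▸ hxy
    have hsymm : hopDist G w H 2 x y = hopDist G w H 2 y x := by
      have key : ∀ x y : V, hopDist G w H 2 x y ≤ hopDist G w H 2 y x := fun x y =>
        le_iInf₂ fun p hp => (iInf₂_le p.reverse (by rwa [SimpleGraph.Walk.length_reverse])).trans
          (walkWeight_reverse _ p).le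
      exact le_antisymm (key x y) (key y x)
    refine ⟨?_, ?_⟩
    · refine (h.near_next_level hlt hx hD hyx h2).resolve_left ?_
      rw [← hsymm]
      exact hhop' i hi
    · exact (h.near_next_level hlt hy hD hxy h1).resolve_left (hhop' i hi)

/-- Go from `u` to its pivot `x` in the base, by two hops to the pivot `y` of `v`, then to `v`. The
base vertex near `u` bounds both pivot distances, so `x` and `y` are at distance at most `2R + 2Δ`.
-/
theorem ContainsHierarchy.four_hops_or_near (h : ContainsHierarchy G w H A c F) {j m : ℕ}
    (hm0 : 0 < m) (hm : m ≤ c) (hF : j * c + m ≤ F) {u v : V} {R Δ : ℝ≥0∞} (hR : R ≠ ∞)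
    (hΔ : Δ ≠ ∞) (hu : ∃ a ∈ A (j * c), graphDist G w u a ≤ R) (huv : graphDist G w u v ≤ Δ) :
    hopDist G w H 4 u v ≤ 4 * m * (R + Δ) ∨
      ∃ a ∈ A (j * c + m), graphDist G w u a ≤ R + m * (2 * R + 2 * Δ) := by
  obtain ⟨a, ha, hua⟩ := hu
  obtain ⟨x, hx, hxH, hxmin⟩ := h.pivot (j * c) (by omega) u a ha (ne_top_of_le_ne_top hR hua)
  have hux : graphDist G w u x ≤ R := (hxmin a ha).trans hua
  have hva : graphDist G w v a ≤ R + Δ := by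
    refine (graphDist_triangle v u a).trans ?_
    rw [graphDist_comm G w v u, add_comm R]
    exact add_le_add huv hua
  have hRΔ : R + Δ ≠ ∞ := ENNReal.add_ne_top.2 ⟨hR, hΔ⟩
  obtain ⟨y, hy, hyH, hymin⟩ := h.pivot (j * c) (by omega) v a ha (ne_top_of_le_ne_top hRΔ hva)
  have hvy : graphDist G w v y ≤ R + Δ := (hymin a ha).trans hva
  have hD : 2 * R + 2 * Δ ≠ ∞ := by
    rw [← mul_add]
    exact ENNReal.mul_ne_top (by norm_num) hRΔ
  have hxy : graphDist G w x y ≤ 2 * R + 2 * Δ := by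
    calc _ ≤ graphDist G w x u + (graphDist G w u v + graphDist G w v y) :=
          (graphDist_triangle x u y).trans (by gcongr; exact graphDist_triangle u v y)
      _ ≤ R + (Δ + (R + Δ)) := by
          gcongr
          rwa [graphDist_comm]
      _ = _ := by ring
  rcases h.two_hops_or_near hm hF hx hy hD hxy with hhop | ⟨⟨b, hb, hxb⟩, -⟩
  · left
    calc hopDist G w H 4 u v ≤ hopDist G w H 1 u x +
          (hopDist G w H 2 x y + hopDist G w H 1 y v) :=
          (hopDist_triangle 1 3 u x v).trans (by gcongr; exact hopDist_triangle 2 1 x y v)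
      _ ≤ R + (hopDist G w H 2 x y + (R + Δ)) := by
          gcongr
          · exact (hopDist_le_graphDist hxH).trans hux
          · refine (hopDist_le_graphDist (by rwa [eq_comm, Sym2.eq_swap])).trans ?_
            rwa [graphDist_comm]
      _ ≤ R + (hopDist G w H 2 x y + (R + Δ)) + Δ := le_self_add
      _ = hopDist G w H 2 x y + (2 * R + 2 * Δ) := by ring
      _ ≤ _ := hhop
      _ = _ := by ring
  · exact Or.inr ⟨b, hb, (graphDist_triangle u x b).trans (add_le_add hux hxb)⟩

/-- The radii of the groups. -/
def groupRadius (c : ℕ) (ρ : ℝ≥0) : ℕ → ℝ≥0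
  | 0 => 0
  | j + 1 => (6 * c + 1) * groupRadius c ρ j + 6 * c * ρ

theorem groupRadius_add (c : ℕ) (ρ : ℝ≥0) (j : ℕ) :
    groupRadius c ρ j + ρ = ρ * (6 * c + 1) ^ j := by
  induction j with
  | zero => simp [groupRadius]
  | succ j ih =>
    rw [groupRadius, pow_succ, ← mul_assoc, ← ih]
    ring

theorem groupRadius_mono (c : ℕ) (ρ : ℝ≥0) : Monotone (groupRadius c ρ) := by
  refine monotone_nat_of_le_succ fun j => ?_
  rw [groupRadius]
  calc groupRadius c ρ j ≤ groupRadius c ρ j + 6 * c * groupRadius c ρ j + 6 * c * ρ :=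
        le_self_add.trans le_self_add
    _ = _ := by ring

variable [Fintype V]

/-- Either four hops suffice, or five hops make progress along a shortest path. -/
theorem ContainsHierarchy.four_hops_or_progress (h : ContainsHierarchy G w H A c F)
    (hA0 : A 0 = Finset.univ) {J m : ℕ} (hm0 : 0 < m) (hm : m ≤ c) (hF : J * c + m = F)
    (hempty : A F = ∅) (ρ : ℝ≥0) {E : ℝ≥0∞} (hE : 4 * m * (groupRadius c ρ J : ℝ≥0∞) ≤ E)
    (hE' : ∀ j < J, 4 * c * (groupRadius c ρ j : ℝ≥0∞) ≤ E) {u v : V}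
    (hfin : graphDist G w u v ≠ ∞) :
    hopDist G w H 4 u v ≤ 6 * c * graphDist G w u v + E ∨
      ∃ y, 3 * (ρ : ℝ≥0∞) < graphDist G w u y ∧
        graphDist G w u y + graphDist G w y v = graphDist G w u v ∧
        hopDist G w H 5 u y ≤ 6 * c * graphDist G w u y := by
  have hc : 0 < c := by omega
  have hcast : (m : ℝ≥0∞) ≤ c := by exact_mod_cast hm
  -- Find a group whose base is near `u` while the next base is far. If there is none, `u` is near
  -- all bases up to the last group, whose final level is empty.
  by_cases hj : ∃ j < J, (∃ a ∈ A (j * c), graphDist G w u a ≤ groupRadius c ρ j) ∧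
      ¬ ∃ a ∈ A ((j + 1) * c), graphDist G w u a ≤ groupRadius c ρ (j + 1)
  · obtain ⟨j, hjJ, hnear, hfar⟩ := hj
    have hjF : j * c + c ≤ F := by
      have : (j + 1) * c ≤ J * c := Nat.mul_le_mul_right c hjJ
      rw [add_mul, one_mul] at this
      omega
    -- The recurrence for the radii is `R + c (2R + 2Δ)` at `Δ = 2R + 3ρ`.
    have hjump : ∀ x, graphDist G w u x ≤ 2 * (groupRadius c ρ j : ℝ≥0∞) + 3 * ρ →
        hopDist G w H 4 u x ≤ 4 * c * (groupRadius c ρ j + graphDist G w u x) := by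
      intro x hx
      have hx' : graphDist G w u x ≠ ∞ := ne_top_of_le_ne_top
        (by exact_mod_cast ENNReal.coe_ne_top (r := 2 * groupRadius c ρ j + 3 * ρ)) hx
      refine (h.four_hops_or_near hc le_rfl hjF ENNReal.coe_ne_top hx' hnear
        le_rfl).resolve_right ?_
      rintro ⟨a, ha, hle⟩
      refine hfar ⟨a, by rwa [add_mul, one_mul], hle.trans ?_⟩
      rw [groupRadius]
      push_cast
      calc _ ≤ (groupRadius c ρ j : ℝ≥0∞) + c * (2 * groupRadius c ρ j +
            2 * (2 * (groupRadius c ρ j : ℝ≥0∞) + 3 * ρ)) := by gcongr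
        _ = _ := by ring
    rcases le_or_gt (graphDist G w u v) (2 * (groupRadius c ρ j : ℝ≥0∞) + 3 * ρ) with hle | hgt
    · left
      calc hopDist G w H 4 u v ≤ 4 * c * (groupRadius c ρ j + graphDist G w u v) := hjump v hle
        _ = 4 * c * graphDist G w u v + 4 * c * groupRadius c ρ j := by ring
        _ ≤ 6 * c * graphDist G w u v + E := by
            gcongr
            · norm_num
            · exact hE' j hjJ
    -- Four hops reach `x` just below the threshold and the edge to `y` crosses it. As `2R` is below
    -- the distance to `y`, the additive `4c R` costs at most `2c` in stretch.
    · obtain ⟨x, y, hadj, hx, hy, hxy, hyv⟩ := exists_crossing_edge hfin hgt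
      refine Or.inr ⟨y, lt_of_le_of_lt le_add_self hy, hyv, ?_⟩
      have h1c : (1 : ℝ≥0∞) ≤ 4 * c := by exact_mod_cast (by omega : 1 ≤ 4 * c)
      calc hopDist G w H 5 u y ≤ hopDist G w H 4 u x + hopDist G w H 1 x y :=
            hopDist_triangle 4 1 u x y
        _ ≤ 4 * c * (groupRadius c ρ j + graphDist G w u x) + w s(x, y) := by
            gcongr
            · exact hjump x hx
            · exact hopDist_le_weight hadj
        _ = 2 * c * (2 * (groupRadius c ρ j : ℝ≥0∞)) + 4 * c * graphDist G w u x +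
            1 * w s(x, y) := by ring
        _ ≤ 2 * c * graphDist G w u y + 4 * c * graphDist G w u x + 4 * c * w s(x, y) := by
            gcongr
            exact le_self_add.trans hy.le
        _ = 2 * c * graphDist G w u y + 4 * c * (graphDist G w u x + w s(x, y)) := by ring
        _ = _ := by rw [hxy]; ring
  · left
    push Not at hj
    have hJ : ∀ j ≤ J, ∃ a ∈ A (j * c), graphDist G w u a ≤ groupRadius c ρ j := by
      intro j
      induction j with
      | zero => exact fun _ => ⟨u, by simp [hA0], by simp [graphDist_self]⟩
      | succ j ihj => exact fun hjJ => hj j (by omega) (ihj (by omega))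
    refine (h.four_hops_or_near hm0 hm hF.le ENNReal.coe_ne_top hfin (hJ J le_rfl)
      le_rfl).elim (fun hhop => hhop.trans ?_) ?_
    · calc 4 * (m : ℝ≥0∞) * (groupRadius c ρ J + graphDist G w u v) =
            4 * m * graphDist G w u v + 4 * m * groupRadius c ρ J := by ring
        _ ≤ 6 * c * graphDist G w u v + E := by
            gcongr
            norm_num
    · rintro ⟨a, ha, -⟩
      rw [hF, hempty] at ha
      simp at ha

/-- Each advance uses five hops and gains more than `3ρ`, so at most `N` occur; the additive error
`E` is paid only once, in the final four hops. -/
theorem ContainsHierarchy.hopDist_le_of_radius (h : ContainsHierarchy G w H A c F)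
    (hA0 : A 0 = Finset.univ) {J m : ℕ} (hm0 : 0 < m) (hm : m ≤ c) (hF : J * c + m = F)
    (hempty : A F = ∅) (ρ : ℝ≥0) {E : ℝ≥0∞} (hE : 4 * m * (groupRadius c ρ J : ℝ≥0∞) ≤ E)
    (hE' : ∀ j < J, 4 * c * (groupRadius c ρ j : ℝ≥0∞) ≤ E) (v : V) (N : ℕ) (u : V)
    (huv : graphDist G w u v ≤ N * (3 * ρ)) :
    hopDist G w H (5 * N + 4) u v ≤ 6 * c * graphDist G w u v + E := by
  have h3ρ : (3 * ρ : ℝ≥0∞) ≠ ∞ := ENNReal.mul_ne_top (by norm_num) ENNReal.coe_ne_top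
  induction N generalizing u with
  | zero =>
    rw [Nat.cast_zero, zero_mul] at huv
    refine (h.four_hops_or_progress hA0 hm0 hm hF hempty ρ hE hE'
      (ne_top_of_le_ne_top ENNReal.zero_ne_top huv)).resolve_right ?_
    rintro ⟨y, hy, hyv, -⟩
    exact ((le_self_add.trans (hyv.le.trans huv)).trans zero_le).not_gt hy
  | succ N ih =>
    rcases h.four_hops_or_progress hA0 hm0 hm hF hempty ρ hE hE' (ne_top_of_le_ne_top
      (ENNReal.mul_ne_top (ENNReal.natCast_ne_top _) h3ρ) huv) with hhop | ⟨y, hy, hyv, hhop⟩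
    · exact (hopDist_mono (by omega) u v).trans hhop
    · have h3 : graphDist G w y v ≤ N * (3 * ρ) := by
        refine (ENNReal.add_le_add_iff_left h3ρ).1 ?_
        calc _ ≤ graphDist G w u y + graphDist G w y v := by gcongr
          _ ≤ (N + 1 : ℕ) * (3 * (ρ : ℝ≥0∞)) := by rw [hyv]; exact huv
          _ = _ := by push_cast; ring
      calc hopDist G w H (5 * (N + 1) + 4) u v ≤
          hopDist G w H 5 u y + hopDist G w H (5 * N + 4) y v := by
            rw [show 5 * (N + 1) + 4 = 5 + (5 * N + 4) by ring]
            exact hopDist_triangle _ _ u y v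
        _ ≤ 6 * c * graphDist G w u y + (6 * c * graphDist G w y v + E) := by
            gcongr
            exact ih y h3
        _ = 6 * c * (graphDist G w u y + graphDist G w y v) + E := by ring
        _ = _ := by rw [hyv]

theorem ContainsHierarchy.isHopset (h : ContainsHierarchy G w H A c F)
    (hA0 : A 0 = Finset.univ) {J m : ℕ} (hm0 : 0 < m) (hm : m ≤ c) (hF : J * c + m = F)
    (hempty : A F = ∅) (hdiag : ∀ e ∈ H, ¬ e.IsDiag) :
    IsHopset G w H (8 * (c : ℝ≥0∞) + 3) (5 * (m * (6 * c + 1) ^ J / c + 1) + 4) := by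
  refine ⟨hdiag, fun u v => ?_⟩
  have hc : 0 < c := by omega
  rcases eq_or_ne (graphDist G w u v) ∞ with htop | hfin
  · rw [htop, ENNReal.mul_top (by simp)]
    exact le_top
  obtain ⟨d, hd⟩ : ∃ d : ℝ≥0, (d : ℝ≥0∞) = graphDist G w u v := ⟨_, ENNReal.coe_toNNReal hfin⟩
  have hmpos : (0 : ℝ≥0) < m := by exact_mod_cast hm0
  have hcpos : (0 : ℝ≥0) < c := by exact_mod_cast hc
  -- Chosen so that the final error `4m` times the last radius is at most `2 c d`.
  set ρ : ℝ≥0 := c * d / (2 * m * (6 * c + 1) ^ J) with hρ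
  have hρ' : 2 * m * (6 * c + 1) ^ J * ρ = c * d := by
    rw [hρ, mul_div_cancel₀]
    positivity
  have h1 : 4 * m * groupRadius c ρ J ≤ 2 * c * d := by
    calc 4 * m * groupRadius c ρ J ≤ 4 * m * (groupRadius c ρ J + ρ) := by
          gcongr
          exact le_self_add
      _ = 2 * (2 * m * (6 * c + 1) ^ J * ρ) := by rw [groupRadius_add]; ring
      _ = _ := by rw [hρ']; ring
  have h2 : ∀ j < J, 4 * c * groupRadius c ρ j ≤ 2 * c * d := by
    intro j hj
    refine le_trans ?_ h1
    have h1m : (1 : ℝ≥0) ≤ 4 * m := by exact_mod_cast (by omega : 1 ≤ 4 * m)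
    calc 4 * c * groupRadius c ρ j ≤ (6 * c + 1) * groupRadius c ρ j + 6 * c * ρ := by
          refine le_add_right ?_
          gcongr
          refine le_add_right ?_
          gcongr
          norm_num
      _ = groupRadius c ρ (j + 1) := rfl
      _ ≤ groupRadius c ρ J := groupRadius_mono c ρ hj
      _ = 1 * groupRadius c ρ J := (one_mul _).symm
      _ ≤ _ := by gcongr
  have h3 : d ≤ (m * (6 * c + 1) ^ J / c + 1 : ℕ) * (3 * ρ) := by
    have h4 : m * (6 * c + 1) ^ J ≤ (m * (6 * c + 1) ^ J / c + 1) * c :=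
      (Nat.lt_mul_div_succ _ hc).le.trans_eq (mul_comm _ _)
    have h5 : (m : ℝ≥0) * (6 * c + 1) ^ J ≤ (m * (6 * c + 1) ^ J / c + 1 : ℕ) * c := by
      exact_mod_cast h4
    refine le_of_mul_le_mul_left ?_ hcpos
    calc c * d = 2 * (m * (6 * c + 1) ^ J * ρ) := by rw [← hρ']; ring
      _ ≤ 3 * ((m * (6 * c + 1) ^ J / c + 1 : ℕ) * c * ρ) := by
          gcongr
          norm_num
      _ = _ := by ring
  have := h.hopDist_le_of_radius hA0 hm0 hm hF hempty ρ (E := ((2 * c * d : ℝ≥0) : ℝ≥0∞))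
    (by exact_mod_cast h1) (fun j hj => by exact_mod_cast h2 j hj) v
    (m * (6 * c + 1) ^ J / c + 1) u (by rw [← hd]; exact_mod_cast h3)
  refine this.trans ?_
  rw [← hd]
  push_cast
  -- The argument yields stretch `8c`; the `3` is slack.
  calc 6 * (c : ℝ≥0∞) * d + 2 * c * d ≤ 6 * (c : ℝ≥0∞) * d + 2 * c * d + 3 * d := le_self_add
    _ = _ := by ring

end Hopset

/-! ### Pivot and bunch pairs, and their closure under successors. -/

section Pairs

variable {n : ℕ} {G : SimpleGraph (Fin n)} {w : Sym2 (Fin n) → ℝ≥0}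

/-- `p` is the nearest vertex of `A` to `u`, and the first one among these. -/
def IsPivot (G : SimpleGraph (Fin n)) (w : Sym2 (Fin n) → ℝ≥0) (A : Finset (Fin n))
    (u p : Fin n) : Prop :=
  p ∈ A ∧ graphDist G w u p ≠ ∞ ∧ ∀ b ∈ A, graphDist G w u p < graphDist G w u b ∨
    graphDist G w u p = graphDist G w u b ∧ p ≤ b

theorem exists_isPivot {A : Finset (Fin n)} {u a : Fin n} (ha : a ∈ A)
    (hfin : graphDist G w u a ≠ ∞) : ∃ p, IsPivot G w A u p := by
  obtain ⟨p, hp, hmin⟩ := A.exists_min_image (fun b => toLex (graphDist G w u b, b)) ⟨a, ha⟩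
  have h : ∀ b ∈ A, graphDist G w u p < graphDist G w u b ∨
      graphDist G w u p = graphDist G w u b ∧ p ≤ b := fun b hb =>
    Prod.Lex.toLex_le_toLex.1 (hmin b hb)
  refine ⟨p, hp, ?_, h⟩
  rcases h a ha with hlt | ⟨heq, -⟩
  · exact ne_top_of_lt hlt
  · rwa [heq]

theorem IsPivot.le {A : Finset (Fin n)} {u p b : Fin n} (h : IsPivot G w A u p) (hb : b ∈ A) :
    graphDist G w u p ≤ graphDist G w u b :=
  (h.2.2 b hb).elim le_of_lt fun h => h.1.le

theorem IsPivot.unique {A : Finset (Fin n)} {u p q : Fin n} (hp : IsPivot G w A u p)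
    (hq : IsPivot G w A u q) : p = q := by
  rcases hp.2.2 q hq.1 with h | ⟨-, h⟩
  · exact absurd (hq.le hp.1) h.not_ge
  rcases hq.2.2 p hp.1 with h' | ⟨-, h'⟩
  · exact absurd (hp.le hq.1) h'.not_ge
  exact le_antisymm h h'

theorem graphDist_nextVertex_ne_top {z r : Fin n} (hzr : z ≠ r) (h : graphDist G w z r ≠ ∞) :
    graphDist G w (nextVertex G w r z) r ≠ ∞ := by
  intro hc
  have := (nextVertex_spec hzr h).2.1
  rw [hc, add_top] at this
  exact h this.symm

/-- A step towards `r` lowers the distance to `r` by exactly the edge weight, and to any other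
vertex by at most that. -/
theorem graphDist_nextVertex_lt {z r x : Fin n} (hzr : z ≠ r) (h : graphDist G w z r ≠ ∞)
    (hx : graphDist G w z r < graphDist G w z x) :
    graphDist G w (nextVertex G w r z) r < graphDist G w (nextVertex G w r z) x := by
  have := hx.trans_le (graphDist_le_add_nextVertex hzr h x)
  rw [← (nextVertex_spec hzr h).2.1] at this
  exact lt_of_add_lt_add_left this

theorem graphDist_nextVertex_le {z r x : Fin n} (hzr : z ≠ r) (h : graphDist G w z r ≠ ∞)
    (hx : graphDist G w z r ≤ graphDist G w z x) :
    graphDist G w (nextVertex G w r z) r ≤ graphDist G w (nextVertex G w r z) x := by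
  have := hx.trans (graphDist_le_add_nextVertex hzr h x)
  rw [← (nextVertex_spec hzr h).2.1] at this
  exact (ENNReal.add_le_add_iff_left ENNReal.coe_ne_top).1 this

/-- Ties are broken by the vertex order, which does not depend on `z`, so `p` keeps winning them. -/
theorem IsPivot.nextVertex {A : Finset (Fin n)} {z p : Fin n} (h : IsPivot G w A z p)
    (hzp : z ≠ p) : IsPivot G w A (nextVertex G w p z) p := by
  refine ⟨h.1, graphDist_nextVertex_ne_top hzp h.2.1, fun b hb => ?_⟩
  rcases h.2.2 b hb with hlt | ⟨heq, hpb⟩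
  · exact Or.inl (graphDist_nextVertex_lt hzp h.2.1 hlt)
  · rcases (graphDist_nextVertex_le hzp h.2.1 heq.le).lt_or_eq with hlt | heq'
    · exact Or.inl hlt
    · exact Or.inr ⟨heq', hpb⟩

open Classical in
/-- The pairs of a vertex and one of its pivots in the first `F` levels. -/
noncomputable def pivotPairs (G : SimpleGraph (Fin n)) (w : Sym2 (Fin n) → ℝ≥0)
    (A : ℕ → Finset (Fin n)) (F : ℕ) : Finset (Fin n × Fin n) :=
  (Finset.range F).biUnion fun i => {x | IsPivot G w (A i) x.1 x.2}

theorem mem_pivotPairs {A : ℕ → Finset (Fin n)} {F : ℕ} {x : Fin n × Fin n} :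
    x ∈ pivotPairs G w A F ↔ ∃ i < F, IsPivot G w (A i) x.1 x.2 := by
  simp [pivotPairs]

theorem card_pivotPairs_le (A : ℕ → Finset (Fin n)) (F : ℕ) :
    (pivotPairs G w A F).card ≤ F * n := by
  classical
  refine (Finset.card_biUnion_le_card_mul _ _ n fun i _ => ?_).trans (by rw [Finset.card_range])
  calc _ ≤ (Finset.univ : Finset (Fin n)).card := by
        refine Finset.card_le_card_of_injOn Prod.fst (fun _ _ => by simp) ?_
        rintro ⟨u, p⟩ hp ⟨v, q⟩ hq (rfl : u = v)
        simp only [Finset.coe_filter, Set.mem_ofPred_eq, Finset.mem_univ, true_and] at hp hq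
        rw [hp.unique hq]
    _ = n := by simp

/-- The pairs of a vertex `u` of the base of the level `i` and a vertex in the bunch of `u`, for
the levels `i` in `I`. -/
noncomputable def bunchPairs (G : SimpleGraph (Fin n)) (w : Sym2 (Fin n) → ℝ≥0)
    (A : ℕ → Finset (Fin n)) (c : ℕ) (I : Finset ℕ) : Finset (Fin n × Fin n) :=
  I.biUnion fun i => (A (i / c * c)).biUnion fun u =>
    (bunch G w (A i) (A (i + 1)) u).image (Prod.mk u)

theorem mem_bunchPairs {A : ℕ → Finset (Fin n)} {c : ℕ} {I : Finset ℕ} {x : Fin n × Fin n} :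
    x ∈ bunchPairs G w A c I ↔
      ∃ i ∈ I, x.1 ∈ A (i / c * c) ∧ x.2 ∈ bunch G w (A i) (A (i + 1)) x.1 := by
  simp only [bunchPairs, Finset.mem_biUnion, Finset.mem_image]
  constructor
  · rintro ⟨i, hi, u, hu, v, hv, rfl⟩
    exact ⟨i, hi, hu, hv⟩
  · rintro ⟨i, hi, hu, hv⟩
    exact ⟨i, hi, x.1, hu, x.2, hv, rfl⟩

theorem card_bunchPairs_le (A : ℕ → Finset (Fin n)) (c : ℕ) (I : Finset ℕ) :
    (bunchPairs G w A c I).card ≤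
      ∑ i ∈ I, ∑ u ∈ A (i / c * c), (bunch G w (A i) (A (i + 1)) u).card :=
  Finset.card_biUnion_le.trans (Finset.sum_le_sum fun _ _ => Finset.card_biUnion_le.trans
    (Finset.sum_le_sum fun _ _ => Finset.card_image_le))

/-- The base of the first group is all of `V`, so the successor is again a base vertex; in later
groups it may leave the base. -/
theorem bunchPairs_closed {A : ℕ → Finset (Fin n)} (hA0 : A 0 = Finset.univ) {c : ℕ}
    {x : Fin n × Fin n} (hx : x ∈ bunchPairs G w A c (Finset.range c)) (hne : x.1 ≠ x.2) :
    (nextVertex G w x.2 x.1, x.2) ∈ bunchPairs G w A c (Finset.range c) := by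
  rw [mem_bunchPairs] at hx ⊢
  obtain ⟨i, hi, -, hb⟩ := hx
  rw [mem_bunch] at hb
  refine ⟨i, hi, ?_, ?_⟩
  · rw [Nat.div_eq_of_lt (Finset.mem_range.1 hi), zero_mul, hA0]
    exact Finset.mem_univ _
  · rw [mem_bunch]
    exact ⟨hb.1, graphDist_nextVertex_ne_top hne hb.2.1,
      fun a ha => graphDist_nextVertex_lt hne hb.2.1 (hb.2.2 a ha)⟩

open Classical in
/-- The unordered pairs of distinct vertices in `R`. -/
noncomputable def edgesOfPairs (R : Finset (Fin n × Fin n)) : Finset (Sym2 (Fin n)) :=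
  (R.image fun x => s(x.1, x.2)).filter fun e => ¬ e.IsDiag

theorem mem_edgesOfPairs {R : Finset (Fin n × Fin n)} {e : Sym2 (Fin n)} :
    e ∈ edgesOfPairs R ↔ (∃ x ∈ R, s(x.1, x.2) = e) ∧ ¬ e.IsDiag := by
  classical
  rw [edgesOfPairs, Finset.mem_filter, Finset.mem_image]

theorem card_edgesOfPairs_le (R : Finset (Fin n × Fin n)) : (edgesOfPairs R).card ≤ R.card := by
  classical
  exact (Finset.card_filter_le _ _).trans Finset.card_image_le

theorem containsHierarchy_of_pairs {A : ℕ → Finset (Fin n)} {c F : ℕ} {H : Finset (Sym2 (Fin n))}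
    (h1 : edgesOfPairs (pivotPairs G w A F) ⊆ H)
    (h2 : edgesOfPairs (bunchPairs G w A c (Finset.range F)) ⊆ H) :
    ContainsHierarchy G w H A c F := by
  refine ⟨fun i hi u a ha hfin => ?_, fun i hi u hu v hv => ?_⟩
  · obtain ⟨p, hp⟩ := exists_isPivot ha hfin
    refine ⟨p, hp.1, ?_, fun b hb => hp.le hb⟩
    rw [or_iff_not_imp_left]
    intro hne
    exact h1 (mem_edgesOfPairs.2 ⟨⟨(u, p), mem_pivotPairs.2 ⟨i, hi, hp⟩, rfl⟩,
      fun hd => hne (Sym2.mk_isDiag_iff.1 hd)⟩)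
  · rw [or_iff_not_imp_left]
    intro hne
    exact h2 (mem_edgesOfPairs.2 ⟨⟨(u, v), mem_bunchPairs.2 ⟨i, Finset.mem_range.2 hi, hu, hv⟩,
      rfl⟩, fun hd => hne (Sym2.mk_isDiag_iff.1 hd)⟩)

end Pairs

/-! ### Level sizes and sampling rates. -/

section Sizes

open Finset

/-- The exponents in the bounds for the sizes of the levels. -/
def levelExponent (c i : ℕ) : ℕ := (c + 1) ^ (i / c) * (i % c + 1)

/-- The increment is the exponent of `η` in `samplingRate`. The case of a last level works because
`(c + 1) ^ j * (c + 1)` starts the next group. -/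
theorem levelExponent_succ {c : ℕ} (hc : 0 < c) (i : ℕ) :
    levelExponent c (i + 1) = levelExponent c i + (c + 1) ^ (i / c) := by
  unfold levelExponent
  have h1 := Nat.div_add_mod i c
  have h2 := Nat.mod_lt i hc
  rcases eq_or_ne (i % c + 1) c with h | h
  · have h3 : i + 1 = c * (i / c + 1) := by rw [mul_add]; omega
    rw [h3, Nat.mul_div_cancel_left _ hc, Nat.mul_mod_right, h]
    ring
  · have h3 : (i + 1) / c = i / c := by
      rw [← h1, add_assoc, Nat.mul_add_div hc, Nat.div_eq_of_lt (show i % c + 1 < c by omega),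
        Nat.mul_add_div hc, Nat.div_eq_of_lt h2]
    have h4 : (i + 1) % c = i % c + 1 := by
      rw [← Nat.mod_add_mod, Nat.mod_eq_of_lt (by omega)]
    rw [h3, h4]
    ring

theorem levelExponent_mul_add {c : ℕ} (hc : 0 < c) (j : ℕ) {m : ℕ} (hm : m ≤ c) :
    levelExponent c (j * c + m) = (c + 1) ^ j * (m + 1) := by
  induction m with
  | zero => simp [levelExponent, hc]
  | succ m ih =>
    rw [← add_assoc, levelExponent_succ hc, ih (by omega), mul_comm j, Nat.mul_add_div hc,
      Nat.div_eq_of_lt (by omega), add_zero]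
    ring

/-- The sampling probability of level `i`. -/
noncomputable def samplingRate (c : ℕ) (η κ : ℝ) (i : ℕ) : ℝ :=
  (if i < c then κ⁻¹ else 1) * (η ^ ((c + 1) ^ (i / c)))⁻¹ / 2

variable {c : ℕ} {η κ : ℝ}

theorem samplingRate_pos (hη : 1 ≤ η) (hκ : 1 ≤ κ) (i : ℕ) : 0 < samplingRate c η κ i := by
  unfold samplingRate
  split_ifs <;> positivity

theorem samplingRate_le_one (hη : 1 ≤ η) (hκ : 1 ≤ κ) (i : ℕ) : samplingRate c η κ i ≤ 1 := by
  unfold samplingRate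
  have h1 : (η ^ ((c + 1) ^ (i / c)))⁻¹ ≤ 1 := inv_le_one_of_one_le₀ (one_le_pow₀ hη)
  have h2 : (if i < c then κ⁻¹ else 1) ≤ 1 := by
    split_ifs
    · exact inv_le_one_of_one_le₀ hκ
    · exact le_rfl
  have h3 : 0 ≤ (η ^ ((c + 1) ^ (i / c)))⁻¹ := by positivity
  have := mul_le_mul h2 h1 h3 zero_le_one
  linarith

/-- The bracket gains the reciprocal of the sampling rate at each level, so the left side never
increases. -/
theorem card_level_le {V : Type*} [DecidableEq V] {A : ℕ → Finset V} (hc : 0 < c) (hη : 1 ≤ η)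
    (hκ : 1 ≤ κ) {X : ℝ} (hA0 : (#(A 0) : ℝ) * η ≤ X)
    (hA : ∀ i, (#(A (i + 1)) : ℝ) ≤ samplingRate c η κ i * #(A i)) (i : ℕ) :
    (#(A i) : ℝ) * (2 ^ i * κ ^ min i c * η ^ levelExponent c i) ≤ X := by
  have hη0 : 0 < η := by linarith
  have hκ0 : 0 < κ := by linarith
  induction i with
  | zero => simpa [levelExponent] using hA0
  | succ i ih =>
    refine le_trans ?_ ih
    calc _ ≤ (samplingRate c η κ i * #(A i)) *
          (2 ^ (i + 1) * κ ^ min (i + 1) c * η ^ levelExponent c (i + 1)) :=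
          mul_le_mul_of_nonneg_right (hA i) (by positivity)
      _ = _ := by
          rw [levelExponent_succ hc, pow_add η, samplingRate]
          rcases lt_or_ge i c with h | h
          · rw [if_pos h, min_eq_left (show i + 1 ≤ c from h), min_eq_left h.le]
            field_simp
            ring
          · rw [if_neg h.not_gt, min_eq_right (by omega), min_eq_right h]
            field_simp
            ring

theorem sum_half_pow_div_le (hc : 0 < c) (J : ℕ) :
    ∑ i ∈ range (J * c), (1 / 2 : ℝ) ^ (i / c) ≤ 2 * c := by
  have h : ∑ i ∈ range (J * c), (1 / 2 : ℝ) ^ (i / c) = c * ∑ j ∈ range J, (1 / 2 : ℝ) ^ j := by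
    induction J with
    | zero => simp
    | succ J ih =>
      rw [add_mul, one_mul, sum_range_add, ih, sum_range_succ, mul_add]
      congr 1
      have : ∀ r ∈ range c, (1 / 2 : ℝ) ^ ((J * c + r) / c) = (1 / 2) ^ J := by
        intro r hr
        rw [mul_comm J, Nat.mul_add_div hc, Nat.div_eq_of_lt (mem_range.1 hr), add_zero]
      rw [sum_congr rfl this, sum_const, card_range, nsmul_eq_mul]
  rw [h, mul_comm 2]
  exact mul_le_mul_of_nonneg_left (sum_geometric_two_le J) (Nat.cast_nonneg c)

end Sizes

/-! ### Cardinalities of the bunches and the hopbound. -/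

section Bounds

open Finset

variable {n : ℕ} {G : SimpleGraph (Fin n)} {w : Sym2 (Fin n) → ℝ≥0} {A : ℕ → Finset (Fin n)}
  {c : ℕ} {η κ : ℝ}

theorem card_bunchPairs_first_group_le (hη : 1 ≤ η) (hκ : 1 ≤ κ) (hA0 : A 0 = univ)
    (hB : ∀ i, samplingRate c η κ i * ∑ u ∈ A (i / c * c),
      (#(bunch G w (A i) (A (i + 1)) u) : ℝ) ≤ 4 * #(A (i / c * c))) :
    (#(bunchPairs G w A c (range c)) : ℝ) ≤ 8 * (c * κ * (n * η)) := by
  have hη0 : 0 < η := by linarith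
  have hκ0 : 0 < κ := by linarith
  have h : ∀ i ∈ range c, ∑ u ∈ A (i / c * c), (#(bunch G w (A i) (A (i + 1)) u) : ℝ) ≤
      8 * (κ * (n * η)) := by
    intro i hi
    have h1 := hB i
    rw [samplingRate, if_pos (mem_range.1 hi), Nat.div_eq_of_lt (mem_range.1 hi), zero_mul, hA0,
      pow_zero, pow_one, card_univ, Fintype.card_fin] at h1
    rw [Nat.div_eq_of_lt (mem_range.1 hi), zero_mul, hA0]
    set s := ∑ u, (#(bunch G w (A i) (A (i + 1)) u) : ℝ)
    calc s = 2 * κ * η * (κ⁻¹ * η⁻¹ / 2 * s) := by field_simp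
      _ ≤ 2 * κ * η * (4 * n) := by gcongr
      _ = _ := by ring
  calc (#(bunchPairs G w A c (range c)) : ℝ) ≤
      ∑ i ∈ range c, ∑ u ∈ A (i / c * c), (#(bunch G w (A i) (A (i + 1)) u) : ℝ) := by
        exact_mod_cast card_bunchPairs_le A c (range c)
    _ ≤ ∑ i ∈ range c, 8 * (κ * (n * η)) := sum_le_sum h
    _ = _ := by rw [sum_const, card_range, nsmul_eq_mul]; ring

theorem card_bunchPairs_later_groups_le (hc : 0 < c) (hη : 1 ≤ η) (hκ : 1 ≤ κ)
    (hA0 : A 0 = univ)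
    (hA : ∀ i, (#(A (i + 1)) : ℝ) ≤ samplingRate c η κ i * #(A i))
    (hB : ∀ i, samplingRate c η κ i * ∑ u ∈ A (i / c * c),
      (#(bunch G w (A i) (A (i + 1)) u) : ℝ) ≤ 4 * #(A (i / c * c))) {F J : ℕ}
    (hF : F ≤ J * c) :
    (#(bunchPairs G w A c (Ico c F)) : ℝ) ≤ 16 * (c * (κ ^ (c - 1))⁻¹ * (n * η)) := by
  have hη0 : 0 < η := by linarith
  have hκ0 : 0 < κ := by linarith
  have h : ∀ i ∈ Ico c F, ∑ u ∈ A (i / c * c), (#(bunch G w (A i) (A (i + 1)) u) : ℝ) ≤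
      8 * ((κ ^ (c - 1))⁻¹ * (n * η)) * (1 / 2) ^ (i / c) := by
    intro i hi
    rw [mem_Ico] at hi
    have h1 := hB i
    set j := i / c with hj
    have hj1 : 1 ≤ j := (Nat.one_le_div_iff hc).2 hi.1
    have h2 := card_level_le hc hη hκ (X := n * η) (by rw [hA0]; simp) hA (j * c)
    have he : levelExponent c (j * c) = (c + 1) ^ j := by
      simpa using levelExponent_mul_add hc j (Nat.zero_le c)
    rw [he, min_eq_right (by nlinarith)] at h2
    rw [samplingRate, if_neg (by omega), ← hj, one_mul] at h1
    set s := ∑ u ∈ A (j * c), (#(bunch G w (A i) (A (i + 1)) u) : ℝ)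
    set E := η ^ ((c + 1) ^ j)
    have hE : 0 < E := by positivity
    set a : ℝ := (#(A (j * c)) : ℝ)
    -- The base of group `j` carries exactly the factor `E` that the reciprocal rate costs. The `κ`
    -- powers give the saving, and `2 ^ j` makes the groups sum geometrically.
    have h3 : a * E * 2 ^ j * κ ^ (c - 1) ≤ n * η := by
      refine le_trans ?_ h2
      have h4 : (2 : ℝ) ^ j ≤ 2 ^ (j * c) :=
        pow_le_pow_right₀ (by norm_num) (Nat.le_mul_of_pos_right j hc)
      have h5 : κ ^ (c - 1) ≤ κ ^ c := pow_le_pow_right₀ hκ (by omega)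
      calc a * E * 2 ^ j * κ ^ (c - 1) ≤ a * E * 2 ^ (j * c) * κ ^ c := by gcongr
        _ = _ := by ring
    calc s = 2 * E * (E⁻¹ / 2 * s) := by field_simp
      _ ≤ 2 * E * (4 * a) := by gcongr
      _ = 8 * (a * E * 2 ^ j * κ ^ (c - 1)) * (κ ^ (c - 1))⁻¹ * (1 / 2) ^ j := by
          rw [one_div, inv_pow]
          field_simp
          ring
      _ ≤ 8 * (n * η) * (κ ^ (c - 1))⁻¹ * (1 / 2) ^ j := by gcongr
      _ = _ := by ring
  have hsum : ∑ i ∈ Ico c F, (1 / 2 : ℝ) ^ (i / c) ≤ 2 * c := by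
    refine le_trans (sum_le_sum_of_subset_of_nonneg (fun i hi => ?_) fun _ _ _ => by positivity)
      (sum_half_pow_div_le hc J)
    rw [mem_Ico] at hi
    exact mem_range.2 (by omega)
  calc (#(bunchPairs G w A c (Ico c F)) : ℝ) ≤
      ∑ i ∈ Ico c F, ∑ u ∈ A (i / c * c), (#(bunch G w (A i) (A (i + 1)) u) : ℝ) := by
        exact_mod_cast card_bunchPairs_le A c (Ico c F)
    _ ≤ ∑ i ∈ Ico c F, 8 * ((κ ^ (c - 1))⁻¹ * (n * η)) * (1 / 2) ^ (i / c) := sum_le_sum h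
    _ = 8 * ((κ ^ (c - 1))⁻¹ * (n * η)) * ∑ i ∈ Ico c F, (1 / 2) ^ (i / c) := by rw [mul_sum]
    _ ≤ 8 * ((κ ^ (c - 1))⁻¹ * (n * η)) * (2 * c) := by gcongr
    _ = _ := by ring

/-- Since `n * η = η ^ (k + 1)`, the level bound leaves at most `2 ^ (-F) < 1` vertices. -/
theorem level_eq_empty (hc : 0 < c) (hη : 1 ≤ η) (hκ : 1 ≤ κ) {k : ℕ} (hk : η ^ k = n)
    (hA0 : A 0 = univ) (hA : ∀ i, (#(A (i + 1)) : ℝ) ≤ samplingRate c η κ i * #(A i)) {F : ℕ}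
    (hF0 : F ≠ 0) (hF : k + 1 ≤ levelExponent c F) : A F = ∅ := by
  by_contra hne
  have h1 : (1 : ℝ) ≤ #(A F) := by
    exact_mod_cast (nonempty_iff_ne_empty.2 hne).card_pos
  have h2 := card_level_le hc hη hκ (X := n * η) (by rw [hA0]; simp) hA F
  have h3 : (n : ℝ) * η ≤ η ^ levelExponent c F := by
    rw [← hk, ← pow_succ]
    exact pow_le_pow_right₀ hη hF
  have h4 : (2 : ℝ) ^ 1 ≤ 2 ^ F := pow_le_pow_right₀ (by norm_num) (by omega)
  have h5 : 1 ≤ κ ^ min F c := one_le_pow₀ hκ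
  have h6 : 0 < η ^ levelExponent c F := by positivity
  have h7 : 1 * (2 ^ 1 * 1 * η ^ levelExponent c F) ≤
      (#(A F) : ℝ) * (2 ^ F * κ ^ min F c * η ^ levelExponent c F) := by gcongr
  linarith

theorem natLog_succ_le_logb {c k : ℕ} (hc : 1 < c) (hk : 0 < k) :
    (Nat.log (c + 1) k : ℝ) ≤ Real.logb c k := by
  rw [Real.le_logb_iff_rpow_le (by exact_mod_cast hc) (by exact_mod_cast hk), Real.rpow_natCast]
  have h1 : c ^ Nat.log (c + 1) k ≤ k :=
    (Nat.pow_le_pow_left (Nat.le_succ c) _).trans (Nat.pow_log_le_self _ hk.ne')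
  exact_mod_cast h1

/-- Bound `6c + 1` by `6 (c + 1)`: the powers of `c + 1` are absorbed in `k`, and `6 ^ J ≤ k ^ (2 /
ln c)` follows from `6 ≤ e ^ 2` and `J ≤ log_c k`. The constant is `5 + 5 + 4`. -/
theorem hopbound_le {c k : ℕ} (hc : 1 < c) (hck : c ≤ k) :
    ((5 * (k / (c + 1) ^ Nat.log (c + 1) k * (6 * c + 1) ^ Nat.log (c + 1) k / c + 1) + 4 : ℕ) :
      ℝ) ≤ 14 * (1 / (c : ℝ) * (k : ℝ) ^ (1 + 2 / Real.log (c : ℝ))) := by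
  set J := Nat.log (c + 1) k with hJ
  set m := k / (c + 1) ^ J with hm
  have hc0 : (0 : ℝ) < c := by exact_mod_cast (by omega : 0 < c)
  have hk0 : (0 : ℝ) < k := by exact_mod_cast (by omega : 0 < k)
  have hck' : (c : ℝ) ≤ k := by exact_mod_cast hck
  have hlogc : 0 < Real.log c := Real.log_pos (by exact_mod_cast hc)
  set P := (k : ℝ) ^ (2 / Real.log (c : ℝ)) with hP
  have h6 : (6 : ℝ) ^ J ≤ P := by
    have h1 := natLog_succ_le_logb hc (show 0 < k by omega)
    have h2 : P = Real.exp (2 * Real.logb c k) := by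
      rw [hP, Real.rpow_def_of_pos hk0, Real.logb]
      congr 1
      ring
    have h3 : (6 : ℝ) ≤ Real.exp 2 := by
      have := Real.exp_one_gt_d9
      rw [show (2 : ℝ) = 1 + 1 by norm_num, Real.exp_add]
      nlinarith
    calc (6 : ℝ) ^ J ≤ Real.exp 2 ^ J := by gcongr
      _ = Real.exp (2 * J) := by rw [mul_comm, Real.exp_nat_mul]
      _ ≤ P := by
          rw [h2]
          gcongr
  have hP1 : 1 ≤ P := (one_le_pow₀ (by norm_num : (1 : ℝ) ≤ 6)).trans h6
  have hkP : (k : ℝ) ^ (1 + 2 / Real.log (c : ℝ)) = k * P := by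
    rw [Real.rpow_add hk0, Real.rpow_one]
  have hmk : (m : ℝ) * (c + 1) ^ J ≤ k := by exact_mod_cast Nat.div_mul_le_self k _
  have hdiv : ((m * (6 * c + 1) ^ J / c : ℕ) : ℝ) ≤ k * P / c := by
    refine Nat.cast_div_le.trans ?_
    push_cast
    refine div_le_div_of_nonneg_right ?_ hc0.le
    calc (m : ℝ) * (6 * c + 1) ^ J ≤ m * (6 * (c + 1)) ^ J := by
          gcongr
          linarith
      _ = m * (c + 1) ^ J * 6 ^ J := by rw [mul_pow]; ring
      _ ≤ k * P := by gcongr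
  have h1 : 1 ≤ k * P / c := by
    rw [one_le_div hc0]
    nlinarith
  rw [hkP, one_div, ← div_eq_inv_mul]
  push_cast at hdiv ⊢
  linarith

end Bounds

theorem hasPathReportingPreserver_zero (G : SimpleGraph (Fin 0)) (w : Sym2 (Fin 0) → ℝ≥0)
    (Q : RamProgram) (a T : ℕ) (H : Finset (Sym2 (Fin 0))) {m : ℝ} (hm : 0 ≤ m) :
    HasPathReportingPreserver Q a T G w H m := by
  refine ⟨⊥, [], ⟨bot_le, by simp, fun u => u.elim0⟩, ?_⟩
  simpa [spannerSize] using hm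

theorem mainTheorem9 :
    ∃ (Q : RamProgram) (a T : ℕ) (C : ℝ),
      ∀ (n c k : ℕ), 1 < c → c ≤ k →
      ∀ (G : SimpleGraph (Fin n)) (w : Sym2 (Fin n) → ℝ≥0),
      ∃ (H H₁ H₂ H₃ : Finset (Sym2 (Fin n))) (β : ℕ),
        IsHopset G w H (8 * (c : ℝ≥0∞) + 3) β ∧
        (β : ℝ) ≤ C * (1 / (c : ℝ) * (k : ℝ) ^ (1 + 2 / Real.log (c : ℝ))) ∧
        (H.card : ℝ) ≤ C * ((c : ℝ) * (n : ℝ) * Real.logb (c : ℝ) (k : ℝ) +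
          (c : ℝ) * (k : ℝ) ^ (9 / ((c : ℝ) - 1)) * (n : ℝ) ^ (1 + 1 / (k : ℝ))) ∧
        H = H₁ ∪ H₂ ∪ H₃ ∧ Disjoint H₁ H₂ ∧ Disjoint H₁ H₃ ∧ Disjoint H₂ H₃ ∧
        HasPathReportingPreserver Q a T G w H₁
          (C * ((c : ℝ) * (n : ℝ) * Real.logb (c : ℝ) (k : ℝ))) ∧
        HasPathReportingPreserver Q a T G w H₂
          (C * ((c : ℝ) * (k : ℝ) ^ (9 / ((c : ℝ) - 1)) * (n : ℝ) ^ (1 + 1 / (k : ℝ)))) ∧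
        (H₃.card : ℝ) ≤ C * ((c : ℝ) * (k : ℝ) ^ (-9 : ℝ) * (n : ℝ) ^ (1 + 1 / (k : ℝ))) := by
  refine ⟨pathQuery, 25, 120, 200, fun n c k hc hck G w => ?_⟩
  have hc0 : 0 < c := by omega
  have hcR : (1 : ℝ) < c := by exact_mod_cast hc
  have hk0 : 0 < k := by omega
  have hkR : (1 : ℝ) ≤ k := by exact_mod_cast hk0
  have hlogb : 1 ≤ Real.logb c k := by
    rw [Real.le_logb_iff_rpow_le hcR (by linarith), Real.rpow_one]
    exact_mod_cast hck
  set κ := (k : ℝ) ^ (9 / ((c : ℝ) - 1)) with hκdef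
  have hκ : 1 ≤ κ := Real.one_le_rpow hkR (div_nonneg (by norm_num) (by linarith))
  set β := 5 * (k / (c + 1) ^ Nat.log (c + 1) k * (6 * c + 1) ^ Nat.log (c + 1) k / c + 1) + 4
  have hβ : (β : ℝ) ≤ 200 * (1 / (c : ℝ) * (k : ℝ) ^ (1 + 2 / Real.log (c : ℝ))) := by
    refine (hopbound_le hc hck).trans (mul_le_mul_of_nonneg_right (by norm_num) ?_)
    positivity
  rcases Nat.eq_zero_or_pos n with rfl | hn
  · have h1 : 0 ≤ 200 * ((c : ℝ) * ((0 : ℕ) : ℝ) * Real.logb c k) := by simp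
    have h2 : 0 ≤ 200 * ((c : ℝ) * κ * ((0 : ℕ) : ℝ) ^ (1 + 1 / (k : ℝ))) := by positivity
    refine ⟨∅, ∅, ∅, ∅, β, ⟨by simp, fun u => u.elim0⟩, hβ, ?_, by simp, by simp, by simp,
      by simp, hasPathReportingPreserver_zero G w _ _ _ _ h1,
      hasPathReportingPreserver_zero G w _ _ _ _ h2, ?_⟩
    · refine (le_of_eq (by simp)).trans (add_nonneg h1 h2 |>.trans_eq (mul_add _ _ _).symm)
    · rw [Finset.card_empty, Nat.cast_zero]
      positivity
  have hnR : (1 : ℝ) ≤ n := by exact_mod_cast hn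
  set η := (n : ℝ) ^ (1 / (k : ℝ)) with hηdef
  have hη : 1 ≤ η := Real.one_le_rpow hnR (by positivity)
  have hηk : η ^ k = n := by
    rw [hηdef, one_div, Real.rpow_inv_natCast_pow (by linarith) hk0.ne']
  have hX : (n : ℝ) ^ (1 + 1 / (k : ℝ)) = n * η := by
    rw [Real.rpow_add (by linarith), Real.rpow_one]
  have hκ9 : (κ ^ (c - 1))⁻¹ = (k : ℝ) ^ (-9 : ℝ) := by
    rw [Real.rpow_neg (by linarith), hκdef, ← Real.rpow_natCast, ← Real.rpow_mul (by linarith),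
      Nat.cast_sub hc0, Nat.cast_one, div_mul_cancel₀ _ (by linarith)]
  obtain ⟨A, hA0, -, hA, hB⟩ := exists_hierarchy G w c (samplingRate c η κ)
    (samplingRate_pos hη hκ) (samplingRate_le_one hη hκ)
  -- The `J` full groups and `m ≤ c` further levels are chosen so that `(c + 1) ^ J * (m + 1) > k`,
  -- which empties level `J * c + m`.
  set J := Nat.log (c + 1) k with hJdef
  set m := k / (c + 1) ^ J with hmdef
  have hpow : (c + 1) ^ J ≤ k := Nat.pow_log_le_self _ hk0.ne'
  have hpow0 : 0 < (c + 1) ^ J := by positivity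
  have hm0 : 0 < m := Nat.div_pos hpow hpow0
  have hmc : m ≤ c := by
    refine Nat.lt_succ_iff.1 (Nat.div_lt_of_lt_mul ?_)
    rw [← pow_succ]
    exact Nat.lt_pow_succ_log_self (by omega) k
  set F := J * c + m with hFdef
  have hFJ : F ≤ (J + 1) * c := by
    rw [add_mul]
    omega
  have hFR : (F : ℝ) ≤ 2 * (c * Real.logb c k) := by
    have h1 : (F : ℝ) ≤ (J + 1) * c := by exact_mod_cast hFJ
    have h2 : (J : ℝ) ≤ Real.logb c k := natLog_succ_le_logb hc hk0
    nlinarith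
  have hempty : A F = ∅ := by
    refine level_eq_empty hc0 hη hκ hηk hA0 hA (by omega) ?_
    rw [levelExponent_mul_add hc0 J hmc]
    exact Nat.lt_mul_div_succ k hpow0
  set R₁ := pivotPairs G w A F
  set R₂ := bunchPairs G w A c (Finset.range c)
  set R₃ := bunchPairs G w A c (Finset.Ico c F)
  set H₁ := edgesOfPairs R₁
  set H₂ := edgesOfPairs R₂ \ H₁
  set H₃ := edgesOfPairs R₃ \ (H₁ ∪ H₂)
  have hR₁ : (R₁.card : ℝ) ≤ 2 * (c * n * Real.logb c k) := by
    calc (R₁.card : ℝ) ≤ F * n := by exact_mod_cast card_pivotPairs_le A F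
      _ ≤ 2 * (c * Real.logb c k) * n := by gcongr
      _ = _ := by ring
  have hR₂ : (R₂.card : ℝ) ≤ 8 * (c * κ * (n * η)) :=
    card_bunchPairs_first_group_le hη hκ hA0 hB
  have hR₃ : (R₃.card : ℝ) ≤ 16 * (c * (k : ℝ) ^ (-9 : ℝ) * (n * η)) := by
    rw [← hκ9]
    exact card_bunchPairs_later_groups_le hc0 hη hκ hA0 hA hB hFJ
  have hH₁ : (H₁.card : ℝ) ≤ R₁.card := by exact_mod_cast card_edgesOfPairs_le R₁
  have hH₂ : (H₂.card : ℝ) ≤ R₂.card := by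
    exact_mod_cast (Finset.card_le_card Finset.sdiff_subset).trans (card_edgesOfPairs_le R₂)
  have hH₃ : (H₃.card : ℝ) ≤ R₃.card := by
    exact_mod_cast (Finset.card_le_card Finset.sdiff_subset).trans (card_edgesOfPairs_le R₃)
  -- Lower bounds by one absorb the additive constant in the preserver size `20 * (#R + 1)`.
  have hcn : 1 ≤ (c : ℝ) * n * Real.logb c k :=
    one_le_mul_of_one_le_of_one_le (one_le_mul_of_one_le_of_one_le hcR.le hnR) hlogb
  have hcκ : 1 ≤ (c : ℝ) * κ * (n * η) :=
    one_le_mul_of_one_le_of_one_le (one_le_mul_of_one_le_of_one_le hcR.le hκ)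
      (one_le_mul_of_one_le_of_one_le hnR hη)
  have h9 : (c : ℝ) * (k : ℝ) ^ (-9 : ℝ) * (n * η) ≤ c * κ * (n * η) := by
    have : (k : ℝ) ^ (-9 : ℝ) ≤ κ :=
      (Real.rpow_le_one_of_one_le_of_nonpos hkR (by norm_num)).trans hκ
    gcongr
  have h9pos : 0 ≤ (c : ℝ) * (k : ℝ) ^ (-9 : ℝ) * (n * η) := by positivity
  have hsub₁ : H₁ ⊆ H₁ ∪ H₂ ∪ H₃ := fun e he => by simp [he]
  have hsub₂ : edgesOfPairs R₂ ⊆ H₁ ∪ H₂ ∪ H₃ := fun e he => by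
    by_cases h : e ∈ H₁ <;> simp [H₂, h, he]
  have hsub₃ : edgesOfPairs R₃ ⊆ H₁ ∪ H₂ ∪ H₃ := fun e he => by
    by_cases h : e ∈ H₁ ∪ H₂
    · exact Finset.mem_union_left _ h
    · exact Finset.mem_union_right _ (Finset.mem_sdiff.2 ⟨he, h⟩)
  have hcontains : ContainsHierarchy G w (H₁ ∪ H₂ ∪ H₃) A c F := by
    refine containsHierarchy_of_pairs hsub₁ fun e he => ?_
    obtain ⟨⟨x, hx, rfl⟩, hd⟩ := mem_edgesOfPairs.1 he
    obtain ⟨i, hi, hx⟩ := mem_bunchPairs.1 hx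
    rcases lt_or_ge i c with hic | hic
    · exact hsub₂ (mem_edgesOfPairs.2
        ⟨⟨x, mem_bunchPairs.2 ⟨i, Finset.mem_range.2 hic, hx⟩, rfl⟩, hd⟩)
    · exact hsub₃ (mem_edgesOfPairs.2 ⟨⟨x, mem_bunchPairs.2
        ⟨i, Finset.mem_Ico.2 ⟨hic, Finset.mem_range.1 hi⟩, hx⟩, rfl⟩, hd⟩)
  have hdiag : ∀ e ∈ H₁ ∪ H₂ ∪ H₃, ¬ e.IsDiag := by
    intro e he
    simp only [Finset.mem_union, H₂, H₃, Finset.mem_sdiff] at he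
    rcases he with (he | he) | he
    · exact (mem_edgesOfPairs.1 he).2
    · exact (mem_edgesOfPairs.1 he.1).2
    · exact (mem_edgesOfPairs.1 he.1).2
  refine ⟨H₁ ∪ H₂ ∪ H₃, H₁, H₂, H₃, β,
    hcontains.isHopset hA0 hm0 hmc rfl hempty hdiag, hβ, ?_, rfl, ?_, ?_, ?_, ?_, ?_, ?_⟩
  · have h1 : ((H₁ ∪ H₂ ∪ H₃).card : ℝ) ≤ H₁.card + H₂.card + H₃.card := by
      exact_mod_cast (Finset.card_union_le _ _).trans
        (Nat.add_le_add_right (Finset.card_union_le _ _) _)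
    rw [hX]
    linarith
  · exact Finset.disjoint_sdiff
  · exact Finset.disjoint_of_subset_left Finset.subset_union_left Finset.disjoint_sdiff
  · exact Finset.disjoint_of_subset_left Finset.subset_union_right Finset.disjoint_sdiff
  · refine hasPathReportingPreserver_of_closed hn R₁ (fun x hx => ?_) (fun x hx hne => ?_) H₁
      (fun e he => (mem_edgesOfPairs.1 he).1) (by linarith)
    · obtain ⟨i, -, hp⟩ := mem_pivotPairs.1 hx
      exact hp.2.1
    · obtain ⟨i, hi, hp⟩ := mem_pivotPairs.1 hx
      exact mem_pivotPairs.2 ⟨i, hi, hp.nextVertex hne⟩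
  · rw [hX]
    refine hasPathReportingPreserver_of_closed hn R₂ (fun x hx => ?_)
      (fun x hx hne => bunchPairs_closed hA0 hx hne) H₂
      (fun e he => (mem_edgesOfPairs.1 (Finset.mem_sdiff.1 he).1).1) (by linarith)
    obtain ⟨i, -, -, hb⟩ := mem_bunchPairs.1 hx
    exact (mem_bunch.1 hb).2.1
  · rw [hX]
    linarith
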